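/- Let $(M,g)$ be a connected smooth $n$-dimensional Riemannian manifold with Levi-Civita connection $\nabla$, and let $V:TM\to TM$ be a smooth map which sends each fiber $T_xM$ into itself. Let $\pi:F_O(M)\to M$ be the orthonormal frame bundle, whose points over $x$ are the linear isometries $u:\mathbb{R}^n\to T_xM$, and let $N=F_O(M)\times\mathbb{R}^n$. For $v\in\mathbb{R}^n$ let $H_v$ be the canonical horizontal vector field on $F_O(M)$: $H_v(u)\in T_uF_O(M)$ is the horizontal lift (with respect to $\nabla$) of $u(v)\in T_{\pi(u)}M$, i.e. the unique horizontal vector in $T_uF_O(M)$ which $\pi_*$ maps to $u(v)$. The vector field $X$ on $N$ is defined as follows. For $(u,v)\in N$ let $x(t)$ be the solution, for $t$ near $0$, of $$\nabla_{\dot x}\dot x=V(\dot x),\qquad x(0)=\pi(u),\quad \dot x(0)=u(v),$$ let $U_\alpha(t)$ be the parallel translates along $x$ of $u(e_\alpha)$, where $e_1,\dots,e_n$ is the standard basis of $\mathbb{R}^n$, and let $\tau(t)e_\alpha=U_\alpha(t)$ and $v(t)=\tau(t)^{-1}\dot x(t)$. Then $t\mapsto(\tau(t),v(t))$ is a smooth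 curve in $N$ starting at $(u,v)$, and $X_{(u,v)}\in T_{(u,v)}N$ is its velocity at $t=0$. These objects are well defined, and for every $(u,v)\in N$ $$X_{(u,v)}=\bigl(H_v(u),\,u^{-1}V(u(v))\bigr),$$ where $T_v\mathbb{R}^n$ is identified with $\mathbb{R}^n$. -/

import Mathlib

open Set Bundle Manifold
open scoped ContDiff Topology

noncomputable section

namespace ForcedGeodesic

/-- The model space `ℝⁿ` with its Euclidean inner product. -/
abbrev Rn (n : ℕ) : Type := EuclideanSpace ℝ (Fin n)

/-- The standard basis vector `e_i` of `ℝⁿ`. -/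
def stdVec (n : ℕ) (i : Fin n) : Rn n := EuclideanSpace.single i (1 : ℝ)

/-! ### Tangent vectors of curves -/

section Curves

variable {F : Type*} [NormedAddCommGroup F] [NormedSpace ℝ F] {K : Type*} [TopologicalSpace K]
  (J : ModelWithCorners ℝ F K) {P : Type*} [TopologicalSpace P] [ChartedSpace K P]

/-- The velocity `γ'(t) ∈ T_{γ(t)} P` of a curve `γ` in a manifold `P`. -/
def velocity (γ : ℝ → P) (t : ℝ) : TangentSpace J (γ t) :=
  mfderiv 𝓘(ℝ, ℝ) J γ t (1 : ℝ)

/-- The curve `γ` passes through `p` at time `t`, is differentiable there, and has velocity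
`ξ ∈ T_p P`. -/
def HasVelocityAt (γ : ℝ → P) (t : ℝ) (p : P) (ξ : TangentSpace J p) : Prop :=
  MDifferentiableAt 𝓘(ℝ, ℝ) J γ t ∧
    (⟨γ t, velocity J γ t⟩ : TangentBundle J P) = ⟨p, ξ⟩

/-- The tangent space at `p` of an embedded submanifold `S` of `P`, as a subset of `T_p P`: the
velocities at time `0` of the smooth curves of `P` which lie in `S` and start at `p`. -/
def tangentTo (S : Set P) (p : P) : Set (TangentSpace J p) :=
  {ξ | ∃ (ε : ℝ) (γ : ℝ → P), 0 < ε ∧ ContMDiffOn 𝓘(ℝ, ℝ) J ∞ γ (Ioo (-ε) ε) ∧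
    (∀ t ∈ Ioo (-ε) ε, γ t ∈ S) ∧ HasVelocityAt J γ 0 p ξ}

end Curves

section Charts

variable {n : ℕ} {M : Type*} [TopologicalSpace M] [ChartedSpace (Rn n) M]
  [IsManifold (𝓡 n) ∞ M]

/-- The components, in the coordinate frame of the chart at `c`, of a tangent vector `w ∈ T_p M`
(for `p` in the domain of that chart). -/
def coords (c p : M) (w : TangentSpace (𝓡 n) p) : Rn n :=
  (trivializationAt (Rn n) (TangentSpace (𝓡 n) : M → Type _) c ⟨p, w⟩).2

/-- The tangent vector at `p` with components `a` in the coordinate frame of the chart at `c`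
(for `p` in the domain of that chart). -/
def ofCoords (c p : M) (a : Rn n) : TangentSpace (𝓡 n) p :=
  (trivializationAt (Rn n) (TangentSpace (𝓡 n) : M → Type _) c).symm p a

end Charts

section LeviCivita

variable {n : ℕ} {M : Type*} [TopologicalSpace M] [ChartedSpace (Rn n) M]
  [IsManifold (𝓡 n) ∞ M] [RiemannianBundle (fun x : M => TangentSpace (𝓡 n) x)]

/-! ### The Levi-Civita connection, through its Christoffel symbols -/

/-- The matrix `g_{ij}(y) = ⟨∂_i, ∂_j⟩` of the metric in the chart at `c`, at the point with
coordinates `y`. -/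
def metricMatrix (c : M) (y : Rn n) : Matrix (Fin n) (Fin n) ℝ := fun i j =>
  inner ℝ (ofCoords c ((extChartAt (𝓡 n) c).symm y) (stdVec n i))
    (ofCoords c ((extChartAt (𝓡 n) c).symm y) (stdVec n j))

/-- The partial derivative `∂_l g_{ij}(y)` in the chart at `c`. -/
def metricPartial (c : M) (y : Rn n) (l i j : Fin n) : ℝ :=
  fderiv ℝ (fun z => metricMatrix c z i j) y (stdVec n l)

/-- The Christoffel symbols of the metric in the chart at `c`:
`Γ^k_{ij} = ½ g^{kl} (∂_i g_{jl} + ∂_j g_{il} - ∂_l g_{ij})`. -/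
def christoffel (c : M) (y : Rn n) (k i j : Fin n) : ℝ :=
  (1 / 2 : ℝ) * ∑ l, (metricMatrix c y)⁻¹ k l *
    (metricPartial c y i j l + metricPartial c y j i l - metricPartial c y l i j)

/-- The vector `Γ(a, b)` of `ℝⁿ` with components `Γ^k_{ij} a^i b^j`. -/
def christoffelMap (c : M) (y a b : Rn n) : Rn n :=
  ∑ k, (∑ i, ∑ j, christoffel c y k i j * a i * b j) • stdVec n k

/-- The covariant derivative `∇_{x'} U (t)` of a vector field `U` along a curve `x`, for the
Levi-Civita connection: in coordinates `dU^k/dt + Γ^k_{ij} (dx^i/dt) U^j`. It does not depend on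
the chart; the chart at `x t` is used. -/
def covDerivAlong (x : ℝ → M) (U : ∀ t, TangentSpace (𝓡 n) (x t)) (t : ℝ) :
    TangentSpace (𝓡 n) (x t) :=
  ofCoords (x t) (x t)
    (deriv (fun s => coords (x t) (x s) (U s)) t +
      christoffelMap (x t) (extChartAt (𝓡 n) (x t) (x t))
        (deriv (fun s => extChartAt (𝓡 n) (x t) (x s)) t) (coords (x t) (x t) (U t)))

/-- The connection map `T_p(TM) → T_{π(p)} M` of the Levi-Civita connection: in coordinates
`(x, v; dx, dv) ↦ dv^k + Γ^k_{ij} dx^i v^j`. Its kernel is the horizontal subspace of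
`T_p(TM)`. -/
def connector (p : TangentBundle (𝓡 n) M) (ξ : TangentSpace (𝓡 n).tangent p) :
    TangentSpace (𝓡 n) p.1 :=
  let dx : Rn n := mfderiv (𝓡 n).tangent 𝓘(ℝ, Rn n)
    (fun q : TangentBundle (𝓡 n) M => extChartAt (𝓡 n) p.1 q.1) p ξ
  let dv : Rn n := mfderiv (𝓡 n).tangent 𝓘(ℝ, Rn n)
    (fun q : TangentBundle (𝓡 n) M => coords p.1 q.1 q.2) p ξ
  ofCoords p.1 p.1
    (dv + christoffelMap p.1 (extChartAt (𝓡 n) p.1 p.1) dx (coords p.1 p.1 p.2))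

/-! ### The orthonormal frame bundle -/

/-- The total space of the vector bundle `Hom(ℝⁿ, TM)` over `M`: pairs of a point `x` of `M` and
a linear map `ℝⁿ → T_x M`. -/
abbrev HomBundle (n : ℕ) (M : Type*) [TopologicalSpace M] [ChartedSpace (Rn n) M]
    [IsManifold (𝓡 n) ∞ M] : Type _ :=
  TotalSpace (Rn n →L[ℝ] Rn n)
    (fun x : M => Bundle.Trivial M (Rn n) x →L[ℝ] TangentSpace (𝓡 n) x)

/-- The model with corners of `Hom(ℝⁿ, TM)`. -/
abbrev homModel (n : ℕ) : ModelWithCorners ℝ (Rn n × (Rn n →L[ℝ] Rn n))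
    (ModelProd (Rn n) (Rn n →L[ℝ] Rn n)) :=
  (𝓡 n).prod 𝓘(ℝ, Rn n →L[ℝ] Rn n)

/-- The vector `u(w) ∈ T_{π(u)} M`, for `w ∈ ℝⁿ`. -/
def app (u : HomBundle n M) (w : Rn n) : TangentSpace (𝓡 n) u.proj := u.snd w

/-- `u⁻¹ : T_{π(u)} M → ℝⁿ`, for a frame `u`. -/
def invApp (u : HomBundle n M) (a : TangentSpace (𝓡 n) u.proj) : Rn n :=
  ContinuousLinearMap.inverse u.snd a

variable (n M) in
/-- The orthonormal frame bundle `F_O(M)`, as an embedded submanifold of `Hom(ℝⁿ, TM)`: the linear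
maps `u : ℝⁿ → T_x M` which preserve the inner products (and so are isometric isomorphisms, as
`dim M = n`). -/
def orthoFrames : Set (HomBundle n M) :=
  {u | ∀ w w' : Rn n, inner ℝ (app u w) (app u w') = inner ℝ w w'}

/-- The evaluation `Hom(ℝⁿ, TM) → TM`, `u ↦ u(w)`. -/
def evalAt (w : Rn n) (u : HomBundle n M) : TangentBundle (𝓡 n) M := ⟨u.proj, app u w⟩

/-- A tangent vector `ξ` at a frame `u` is horizontal: its image in `T(TM)` under `u ↦ u(w)` is
horizontal for each `w ∈ ℝⁿ`. -/
def IsHorizontal (u : HomBundle n M) (ξ : TangentSpace (homModel n) u) : Prop :=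
  ∀ w : Rn n, connector (evalAt w u)
    (mfderiv (homModel n) (𝓡 n).tangent (evalAt (M := M) w) u ξ) = 0

/-- `ξ ∈ T_u F_O(M)` is a horizontal lift of `a ∈ T_{π(u)} M`. -/
def IsHorizontalLift (u : HomBundle n M) (a : TangentSpace (𝓡 n) u.proj)
    (ξ : TangentSpace (homModel n) u) : Prop :=
  ξ ∈ tangentTo (homModel n) (orthoFrames n M) u ∧ IsHorizontal u ξ ∧
    mfderiv (homModel n) (𝓡 n) (fun q : HomBundle n M => q.proj) u ξ = a

/-- The canonical horizontal vector field `H_v`: its value at `u` is the horizontal lift of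
`u(v)`. -/
def canonicalHorizontal (v : Rn n) (u : HomBundle n M) : TangentSpace (homModel n) u :=
  Classical.epsilon (IsHorizontalLift u (app u v))

/-! ### Forced geodesics with a parallel frame, and the vector field `X` -/

/-- The curve `t ↦ (τ(t), v(t))`, for `|t| < ε`, built from the pair `(u, v)`: the curve
`x = π ∘ τ` is a forced geodesic `∇_{x'} x' = V(x')` with `x(0) = π(u)` and `x'(0) = u(v)`, the
vector fields `U_α = τ e_α` are the parallel translates of `u(e_α)` along `x`, and
`v(t) = τ(t)⁻¹ x'(t)`. -/
structure IsForcedFrameCurve (V : ∀ x : M, TangentSpace (𝓡 n) x → TangentSpace (𝓡 n) x)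
    (u : HomBundle n M) (v : Rn n) (ε : ℝ) (τ : ℝ → HomBundle n M) (vt : ℝ → Rn n) : Prop where
  pos : 0 < ε
  smooth : ContMDiffOn 𝓘(ℝ, ℝ) (𝓡 n) ∞ (fun t => (τ t).proj) (Ioo (-ε) ε)
  geodesic : ∀ t ∈ Ioo (-ε) ε,
    covDerivAlong (fun s => (τ s).proj) (fun s => velocity (𝓡 n) (fun r => (τ r).proj) s) t =
      V (τ t).proj (velocity (𝓡 n) (fun r => (τ r).proj) t)
  init : τ 0 = u
  init_velocity : velocity (𝓡 n) (fun r => (τ r).proj) 0 = app (τ 0) v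
  smooth_frame : ∀ α : Fin n,
    ContMDiffOn 𝓘(ℝ, ℝ) (𝓡 n).tangent ∞ (fun t => evalAt (stdVec n α) (τ t)) (Ioo (-ε) ε)
  parallel : ∀ α : Fin n, ∀ t ∈ Ioo (-ε) ε,
    covDerivAlong (fun s => (τ s).proj) (fun s => app (τ s) (stdVec n α)) t = 0
  velocity_eq : ∀ t ∈ Ioo (-ε) ε, vt t = invApp (τ t) (velocity (𝓡 n) (fun r => (τ r).proj) t)

/-- The model with corners of `Hom(ℝⁿ, TM) × ℝⁿ`, which contains `N = F_O(M) × ℝⁿ`. -/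
abbrev phaseModel (n : ℕ) : ModelWithCorners ℝ ((Rn n × (Rn n →L[ℝ] Rn n)) × Rn n)
    (ModelProd (ModelProd (Rn n) (Rn n →L[ℝ] Rn n)) (Rn n)) :=
  (homModel n).prod 𝓘(ℝ, Rn n)

variable (n M) in
/-- `N = F_O(M) × ℝⁿ`. -/
def phaseSpace : Set (HomBundle n M × Rn n) := orthoFrames n M ×ˢ univ

/-- The vector field `X`: its value at `(u, v)` is the velocity at time `0` of the curve
`t ↦ (τ(t), v(t))` built from `(u, v)`. -/
def forcedField (V : ∀ x : M, TangentSpace (𝓡 n) x → TangentSpace (𝓡 n) x)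
    (p : HomBundle n M × Rn n) : TangentSpace (phaseModel n) p :=
  Classical.epsilon fun ξ => ∃ (ε : ℝ) (τ : ℝ → HomBundle n M) (vt : ℝ → Rn n),
    IsForcedFrameCurve V p.1 p.2 ε τ vt ∧ HasVelocityAt (phaseModel n) (fun t => (τ t, vt t)) 0 p ξ

/-- The tangent vector of `Hom(ℝⁿ, TM) × ℝⁿ` at `(u, v)` with components `ξ` and `b`, where
`T_v ℝⁿ` is identified with `ℝⁿ`. -/
def tangentPair {u : HomBundle n M} {v : Rn n} (ξ : TangentSpace (homModel n) u) (b : Rn n) :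
    TangentSpace (phaseModel n) (u, v) := (ξ, b)

end LeviCivita

end ForcedGeodesic

end

open ForcedGeodesic

noncomputable section

set_option maxSynthPendingDepth 3

open Set Bundle Manifold
open scoped ContDiff Topology

namespace ForcedGeodesic

/-! Let (τ, v) be a curve as in the definition of X, over the base curve x. Since the fields τ e_α
are parallel, τ'(0) is horizontal; it projects to x'(0) = u(v); and parallel transport preserves
inner products, so τ stays in F_O(M) and τ'(0) is tangent to it. A horizontal lift is unique, hence
τ'(0) = H_v(u) (`isHorizontalLift`, `horizontalLift_unique`). Differentiating x' = τ v covariantly,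
with τ parallel, gives V(x') = ∇x' = τ v', so v'(0) = u⁻¹ V(u(v)) (`hasDerivAt_vt`).

Every admissible curve therefore has the same initial velocity, which makes X well defined with no
appeal to uniqueness of forced geodesics. What remains is that one curve exists; it also supplies
the horizontal lift. In the chart at π(u) the equations for position, velocity and frame form one
smooth first-order system, solved by `exists_smooth_integralCurve`.

`covDerivAlong` at time t uses the chart at x(t), whereas the system lives in a fixed chart.
`covDerivAlong_eq` bridges the two, through the transformation law of the Christoffel symbols. That
law (`christoffel_transform`) and metric compatibility (`hasDerivAt_inner`) are both derived from
the Koszul formula in coordinates, `metricForm_christoffelL`. -/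

lemma hasDerivAt_of_hasMFDerivAt {F : Type*} [NormedAddCommGroup F] [NormedSpace ℝ F]
    {f : ℝ → F} {t : ℝ} {L : ℝ →L[ℝ] F} (h : HasMFDerivAt 𝓘(ℝ, ℝ) 𝓘(ℝ, F) f t L) :
    HasDerivAt f (L 1) t := by
  have h' : HasFDerivAt f L t := hasMFDerivAt_iff_hasFDerivAt.1 h
  exact h'.hasDerivAt

/-! ### Coordinates on M and on TM -/

section Charts

variable {n : ℕ} {M : Type*} [TopologicalSpace M] [ChartedSpace (Rn n) M]

lemma symm_mem_source {c : M} {z : Rn n} (hz : z ∈ (extChartAt (𝓡 n) c).target) :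
    (extChartAt (𝓡 n) c).symm z ∈ (chartAt (Rn n) c).source := by
  rw [← extChartAt_source (𝓡 n)]
  exact (extChartAt (𝓡 n) c).map_target hz

lemma extChartAt_mem_target {c p : M} (hp : p ∈ (chartAt (Rn n) c).source) :
    extChartAt (𝓡 n) c p ∈ (extChartAt (𝓡 n) c).target :=
  (extChartAt (𝓡 n) c).map_source (by rwa [extChartAt_source])

lemma symm_extChartAt {c p : M} (hp : p ∈ (chartAt (Rn n) c).source) :
    (extChartAt (𝓡 n) c).symm (extChartAt (𝓡 n) c p) = p :=
  (extChartAt (𝓡 n) c).left_inv (by rwa [extChartAt_source])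

end Charts

section Coordinates

variable {n : ℕ} {M : Type*} [TopologicalSpace M] [ChartedSpace (Rn n) M]
  [IsManifold (𝓡 n) ∞ M]

/-- The map `coords c p` as a continuous linear map. -/
def coordsL (c p : M) : TangentSpace (𝓡 n) p →L[ℝ] Rn n :=
  (trivializationAt (Rn n) (TangentSpace (𝓡 n) : M → Type _) c).continuousLinearMapAt ℝ p

/-- The map `ofCoords c p` as a continuous linear map. -/
def ofCoordsL (c p : M) : Rn n →L[ℝ] TangentSpace (𝓡 n) p :=
  (trivializationAt (Rn n) (TangentSpace (𝓡 n) : M → Type _) c).symmL ℝ p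

lemma mem_baseSet {c p : M} (hp : p ∈ (chartAt (Rn n) c).source) :
    p ∈ (trivializationAt (Rn n) (TangentSpace (𝓡 n) : M → Type _) c).baseSet := by
  simpa using hp

lemma ofCoordsL_apply {c p : M} (hp : p ∈ (chartAt (Rn n) c).source) (a : Rn n) :
    ofCoordsL c p a = ofCoords c p a :=
  Trivialization.symmL_apply _ (mem_baseSet hp) a

lemma coordsL_apply {c p : M} (hp : p ∈ (chartAt (Rn n) c).source) (w : TangentSpace (𝓡 n) p) :
    coordsL c p w = coords c p w := by
  rw [coordsL, coords, Trivialization.continuousLinearMapAt_apply,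
    Trivialization.linearMapAt_apply, if_pos (mem_baseSet hp)]

lemma ofCoords_coords {c p : M} (hp : p ∈ (chartAt (Rn n) c).source)
    (w : TangentSpace (𝓡 n) p) : ofCoords c p (coords c p w) = w := by
  rw [← coordsL_apply hp, ← ofCoordsL_apply hp]
  exact Trivialization.symmL_continuousLinearMapAt (R := ℝ) _ (mem_baseSet hp) w

lemma coords_ofCoords {c p : M} (hp : p ∈ (chartAt (Rn n) c).source) (a : Rn n) :
    coords c p (ofCoords c p a) = a := by
  rw [← coordsL_apply hp, ← ofCoordsL_apply hp]
  exact Trivialization.continuousLinearMapAt_symmL (R := ℝ) _ (mem_baseSet hp) a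

lemma coords_injective {c p : M} (hp : p ∈ (chartAt (Rn n) c).source) :
    Function.Injective (coords c p : TangentSpace (𝓡 n) p → Rn n) :=
  Function.LeftInverse.injective (ofCoords_coords hp)

lemma ofCoords_injective {c p : M} (hp : p ∈ (chartAt (Rn n) c).source) :
    Function.Injective (ofCoords c p : Rn n → TangentSpace (𝓡 n) p) :=
  Function.LeftInverse.injective (coords_ofCoords hp)

/-- Links the trivialization of TM to the differential of the chart, so that components of
velocities come from the chain rule. -/
lemma coords_eq_mfderiv {c p : M} (hp : p ∈ (chartAt (Rn n) c).source)
    (w : TangentSpace (𝓡 n) p) :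
    coords c p w = (mfderiv (𝓡 n) 𝓘(ℝ, Rn n) (extChartAt (𝓡 n) c) p w : Rn n) := by
  rw [← coordsL_apply hp, coordsL, TangentBundle.continuousLinearMapAt_trivializationAt hp]
  rfl

section Total

variable {F : Type*} [NormedAddCommGroup F] [NormedSpace ℝ F] {K : Type*} [TopologicalSpace K]
  {J : ModelWithCorners ℝ F K} {P : Type*} [TopologicalSpace P] [ChartedSpace K P]

lemma contMDiffAt_tangent_iff {f : P → TangentBundle (𝓡 n) M} {q : P} {c : M}
    (hq : (f q).1 ∈ (chartAt (Rn n) c).source) :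
    ContMDiffAt J (𝓡 n).tangent ∞ f q ↔ ContMDiffAt J (𝓡 n) ∞ (fun r => (f r).1) q ∧
      ContMDiffAt J 𝓘(ℝ, Rn n) ∞ (fun r => coords c (f r).1 (f r).2) q :=
  (trivializationAt (Rn n) (TangentSpace (𝓡 n) : M → Type _) c).contMDiffAt_iff (by
    rw [Trivialization.mem_source]; exact mem_baseSet hq)

lemma contMDiffAt_chart_iff {f : P → M} {q : P} {c : M}
    (hf : ContinuousAt f q) (hq : f q ∈ (chartAt (Rn n) c).source) :
    ContMDiffAt J (𝓡 n) ∞ f q ↔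
      ContMDiffAt J 𝓘(ℝ, Rn n) ∞ (fun r => extChartAt (𝓡 n) c (f r)) q := by
  rw [contMDiffAt_iff_target_of_mem_source hq]
  exact ⟨fun h => h.2, fun h => ⟨hf, h⟩⟩

lemma contMDiffAt_coords (q : TangentBundle (𝓡 n) M) {c : M}
    (hq : q.1 ∈ (chartAt (Rn n) c).source) :
    ContMDiffAt (𝓡 n).tangent 𝓘(ℝ, Rn n) ∞
      (fun r : TangentBundle (𝓡 n) M => coords c r.1 r.2) q :=
  ((contMDiffAt_tangent_iff (f := id) hq).1 contMDiffAt_id).2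

lemma contMDiffAt_chart_proj (q : TangentBundle (𝓡 n) M) {c : M}
    (hq : q.1 ∈ (chartAt (Rn n) c).source) :
    ContMDiffAt (𝓡 n).tangent 𝓘(ℝ, Rn n) ∞
      (fun r : TangentBundle (𝓡 n) M => extChartAt (𝓡 n) c r.1) q :=
  (contMDiffAt_extChartAt' hq).comp q
    ((contMDiffAt_tangent_iff (f := id) hq).1 contMDiffAt_id).1

end Total

lemma contMDiffAt_chart_symm {c : M} {z : Rn n} (hz : z ∈ (extChartAt (𝓡 n) c).target) :
    ContMDiffAt 𝓘(ℝ, Rn n) (𝓡 n) ∞ (extChartAt (𝓡 n) c).symm z :=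
  (contMDiffOn_extChartAt_symm c).contMDiffAt ((isOpen_extChartAt_target c).mem_nhds hz)

lemma contMDiffAt_ofCoords {c : M} {q : Rn n × Rn n} (hz : q.1 ∈ (extChartAt (𝓡 n) c).target) :
    ContMDiffAt 𝓘(ℝ, Rn n × Rn n) (𝓡 n).tangent ∞
      (fun r : Rn n × Rn n => (⟨(extChartAt (𝓡 n) c).symm r.1,
        ofCoords c ((extChartAt (𝓡 n) c).symm r.1) r.2⟩ : TangentBundle (𝓡 n) M)) q := by
  have h1 : ContMDiffAt 𝓘(ℝ, Rn n × Rn n) (𝓡 n) ∞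
      (fun r : Rn n × Rn n => (extChartAt (𝓡 n) c).symm r.1) q :=
    ContMDiffAt.comp q (g := (extChartAt (𝓡 n) c).symm) (contMDiffAt_chart_symm hz)
      contDiff_fst.contMDiff.contMDiffAt
  rw [contMDiffAt_tangent_iff (c := c) (symm_mem_source hz)]
  refine ⟨h1, ?_⟩
  refine (contDiff_snd (𝕜 := ℝ) (E := Rn n)
    (F := Rn n)).contMDiff.contMDiffAt.congr_of_eventuallyEq ?_
  filter_upwards [continuous_fst.continuousAt.preimage_mem_nhds
    ((isOpen_extChartAt_target c).mem_nhds hz)] with r hr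
  exact coords_ofCoords (symm_mem_source hr) _

/-- The coordinates of the velocity of a curve are the derivatives of its coordinates. -/
lemma coords_velocity {x : ℝ → M} {t : ℝ} {c : M} (hx : MDifferentiableAt 𝓘(ℝ, ℝ) (𝓡 n) x t)
    (hc : x t ∈ (chartAt (Rn n) c).source) :
    HasDerivAt (fun s => extChartAt (𝓡 n) c (x s)) (coords c (x t) (velocity (𝓡 n) x t)) t := by
  have h := (mdifferentiableAt_extChartAt (I := 𝓡 n) hc).hasMFDerivAt.comp t hx.hasMFDerivAt
  rw [coords_eq_mfderiv hc]
  exact hasDerivAt_of_hasMFDerivAt h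

end Coordinates

/-! ### Metrics and Christoffel symbols on a normed space -/

section Calculus

variable {E F H : Type*} [NormedAddCommGroup E] [NormedSpace ℝ E] [NormedAddCommGroup F]
  [NormedSpace ℝ F] [NormedAddCommGroup H] [NormedSpace ℝ H]

lemma contDiffAt_smul_const {f : E → ℝ} {z : E} (hf : ContDiffAt ℝ ∞ f z) (v : F) :
    ContDiffAt ℝ ∞ (fun y => f y • v) z :=
  hf.smul contDiffAt_const

lemma fderiv_apply_apply_const {G : E → F →L[ℝ] F →L[ℝ] H} {z : E} (hG : DifferentiableAt ℝ G z)
    (a b : F) (e : E) : fderiv ℝ (fun y => G y a b) z e = fderiv ℝ G z e a b := by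
  have h := (hG.hasFDerivAt.clm_apply (hasFDerivAt_const a z)).clm_apply (hasFDerivAt_const b z)
  rw [h.fderiv]
  simp

/-- The Koszul formula follows from its special case for the vectors of a spanning family. -/
lemma koszul_of_span {ι : Type*} {e : ι → E} (he : Submodule.span ℝ (range e) = ⊤)
    {G : E →L[ℝ] E →L[ℝ] ℝ} {Γ : E →L[ℝ] E →L[ℝ] E} {D : E →L[ℝ] E →L[ℝ] E →L[ℝ] ℝ}
    (h : ∀ i j m, 2 * G (Γ (e i) (e j)) (e m) =
      D (e i) (e j) (e m) + D (e j) (e i) (e m) - D (e m) (e i) (e j)) (a b w : E) :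
    2 * G (Γ a b) w = D a b w + D b a w - D w a b := by
  have hmem : ∀ a : E, a ∈ Submodule.span ℝ (range e) := fun a => he ▸ Submodule.mem_top
  -- Both sides are linear in each argument; the arguments are freed one at a time, the last one
  -- first.
  have h1 : ∀ i j w, 2 * G (Γ (e i) (e j)) w =
      D (e i) (e j) w + D (e j) (e i) w - D w (e i) (e j) := by
    intro i j w
    induction hmem w using Submodule.span_induction with
    | mem x hx => obtain ⟨m, rfl⟩ := hx; exact h i j m
    | zero => simp
    | add x y _ _ hx hy => simp only [map_add, add_apply] at hx hy ⊢; linarith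
    | smul r x _ hx =>
      simp only [map_smul, smul_apply, smul_eq_mul] at hx ⊢
      linear_combination r * hx
  have h2 : ∀ i b w, 2 * G (Γ (e i) b) w =
      D (e i) b w + D b (e i) w - D w (e i) b := by
    intro i b w
    induction hmem b using Submodule.span_induction with
    | mem x hx => obtain ⟨m, rfl⟩ := hx; exact h1 i m w
    | zero => simp
    | add x y _ _ hx hy => simp only [map_add, add_apply] at hx hy ⊢; linarith
    | smul r x _ hx =>
      simp only [map_smul, smul_apply, smul_eq_mul] at hx ⊢
      linear_combination r * hx
  induction hmem a using Submodule.span_induction with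
  | mem x hx => obtain ⟨m, rfl⟩ := hx; exact h2 m b w
  | zero => simp
  | add x y _ _ hx hy => simp only [map_add, add_apply] at hx hy ⊢; linarith
  | smul r x _ hx =>
    simp only [map_smul, smul_apply, smul_eq_mul] at hx ⊢
    linear_combination r * hx

/-- The transformation law of the Christoffel symbols: if `φ` pulls the metric `G'` back to `G`,
then `Dφ Γ(a, b) = Γ'(Dφ a, Dφ b) + D²φ(a, b)`. -/
lemma christoffel_transform {G G' : E → E →L[ℝ] E →L[ℝ] ℝ} {φ : E → E} {z : E}
    {Γ Γ' : E →L[ℝ] E →L[ℝ] E} (hφ : ContDiffAt ℝ 2 φ z) (hG' : DifferentiableAt ℝ G' (φ z))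
    (hG : DifferentiableAt ℝ G z)
    (hpull : ∀ᶠ y in 𝓝 z, ∀ a b, G y a b = G' (φ y) (fderiv ℝ φ y a) (fderiv ℝ φ y b))
    (hsymm : ∀ a b, G' (φ z) a b = G' (φ z) b a)
    (hext : ∀ a b, (∀ w, G' (φ z) a w = G' (φ z) b w) → a = b)
    (hsurj : Function.Surjective (fderiv ℝ φ z))
    (hΓ : ∀ a b w, 2 * G z (Γ a b) w =
      fderiv ℝ G z a b w + fderiv ℝ G z b a w - fderiv ℝ G z w a b)
    (hΓ' : ∀ a b w, 2 * G' (φ z) (Γ' a b) w =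
      fderiv ℝ G' (φ z) a b w + fderiv ℝ G' (φ z) b a w - fderiv ℝ G' (φ z) w a b) (a b : E) :
    fderiv ℝ φ z (Γ a b) =
      Γ' (fderiv ℝ φ z a) (fderiv ℝ φ z b) + fderiv ℝ (fderiv ℝ φ) z a b := by
  have hφ1 : HasFDerivAt φ (fderiv ℝ φ z) z := (hφ.differentiableAt (by simp)).hasFDerivAt
  have hφ2 : HasFDerivAt (fderiv ℝ φ) (fderiv ℝ (fderiv ℝ φ) z) z :=
    ((hφ.fderiv_right (m := 1) (by norm_num)).differentiableAt (by simp)).hasFDerivAt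
  have hsymm2 : ∀ a b, fderiv ℝ (fderiv ℝ φ) z a b = fderiv ℝ (fderiv ℝ φ) z b a := fun a b =>
    (hφ.isSymmSndFDerivAt (by simp)) a b
  -- Product rule applied to the pullback identity `hpull`.
  have hD : ∀ e a b, fderiv ℝ G z e a b =
      fderiv ℝ G' (φ z) (fderiv ℝ φ z e) (fderiv ℝ φ z a) (fderiv ℝ φ z b) +
      G' (φ z) (fderiv ℝ (fderiv ℝ φ) z e a) (fderiv ℝ φ z b) +
      G' (φ z) (fderiv ℝ φ z a) (fderiv ℝ (fderiv ℝ φ) z e b) := by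
    intro e a b
    have h1 := ((hG'.hasFDerivAt.comp z hφ1).clm_apply
      (hφ2.clm_apply (hasFDerivAt_const a z))).clm_apply (hφ2.clm_apply (hasFDerivAt_const b z))
    rw [← fderiv_apply_apply_const hG]
    have h2 : (fun y => G y a b) =ᶠ[𝓝 z]
        fun y => G' (φ y) (fderiv ℝ φ y a) (fderiv ℝ φ y b) := hpull.mono fun y hy => hy a b
    rw [h2.fderiv_eq]
    have h3 := h1.fderiv
    simp only [Function.comp_apply] at h3
    rw [h3]
    simp
    ring
  -- By nondegeneracy of G' it suffices to pair with all vectors, and by surjectivity of Dφ these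
  -- have the form Dφ w.
  apply hext
  intro w'
  obtain ⟨w, rfl⟩ := hsurj w'
  have h1 := hΓ a b w
  rw [hpull.self_of_nhds, hD, hD, hD] at h1
  have h2 := hΓ' (fderiv ℝ φ z a) (fderiv ℝ φ z b) (fderiv ℝ φ z w)
  rw [map_add, add_apply]
  -- Of the six terms with second derivatives of φ in the Koszul expression, four cancel by
  -- symmetry; what is left is 2 G'(D²φ(a, b), Dφ w).
  rw [hsymm2 b a, hsymm2 w a, hsymm2 w b, hsymm (fderiv ℝ φ z b),
    hsymm (fderiv ℝ φ z a)] at h1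
  have h4 := hsymm (fderiv ℝ (fderiv ℝ φ) z b w) (fderiv ℝ φ z a)
  linarith

/-- The covariant derivative along a curve transforms as a vector under a change of chart. -/
lemma covariant_transform {φ : E → E} {y a y₁ a₁ : ℝ → E} {t : ℝ} {y' a' : E}
    {Γ Γ' : E →L[ℝ] E →L[ℝ] E} (hφ : ContDiffAt ℝ 2 φ (y t))
    (htrans : ∀ v w, fderiv ℝ φ (y t) (Γ v w) =
      Γ' (fderiv ℝ φ (y t) v) (fderiv ℝ φ (y t) w) + fderiv ℝ (fderiv ℝ φ) (y t) v w)
    (hy : HasDerivAt y y' t) (ha : HasDerivAt a a' t)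
    (hy₁ : y₁ =ᶠ[𝓝 t] fun s => φ (y s)) (ha₁ : a₁ =ᶠ[𝓝 t] fun s => fderiv ℝ φ (y s) (a s)) :
    deriv a₁ t + Γ' (deriv y₁ t) (a₁ t) = fderiv ℝ φ (y t) (deriv a t + Γ (deriv y t) (a t)) := by
  have hφ1 : HasFDerivAt φ (fderiv ℝ φ (y t)) (y t) :=
    (hφ.differentiableAt (by simp)).hasFDerivAt
  have hφ2 : HasFDerivAt (fderiv ℝ φ) (fderiv ℝ (fderiv ℝ φ) (y t)) (y t) :=
    ((hφ.fderiv_right (m := 1) (by norm_num)).differentiableAt (by simp)).hasFDerivAt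
  have h1 := ((hφ1.comp_hasDerivAt t hy).congr_of_eventuallyEq hy₁).deriv
  -- The term D²φ(y', a) from differentiating Dφ(y) a is exactly the inhomogeneous term of `htrans`.
  have h2 := (((hφ2.comp_hasDerivAt t hy).clm_apply ha).congr_of_eventuallyEq ha₁).deriv
  rw [h1, h2, hy.deriv, ha.deriv, ha₁.self_of_nhds, map_add, htrans]
  simp only [Function.comp_apply]
  abel

/-- Compatibility of the Levi-Civita connection with the metric, in coordinates. -/
lemma hasDerivAt_metric {G : E → E →L[ℝ] E →L[ℝ] ℝ} {y a b : ℝ → E} {t : ℝ}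
    {Γ : E →L[ℝ] E →L[ℝ] E} (hG : DifferentiableAt ℝ G (y t))
    (hsymm : ∀ᶠ z in 𝓝 (y t), ∀ v w, G z v w = G z w v)
    (hΓ : ∀ v w x, 2 * G (y t) (Γ v w) x =
      fderiv ℝ G (y t) v w x + fderiv ℝ G (y t) w v x - fderiv ℝ G (y t) x v w)
    (hy : DifferentiableAt ℝ y t) (ha : DifferentiableAt ℝ a t) (hb : DifferentiableAt ℝ b t) :
    HasDerivAt (fun s => G (y s) (a s) (b s))
      (G (y t) (deriv a t + Γ (deriv y t) (a t)) (b t) +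
        G (y t) (a t) (deriv b t + Γ (deriv y t) (b t))) t := by
  have h := ((hG.hasFDerivAt.comp_hasDerivAt t hy.hasDerivAt).clm_apply ha.hasDerivAt).clm_apply
    hb.hasDerivAt
  refine h.congr_deriv ?_
  have hDs : ∀ e v w, fderiv ℝ G (y t) e v w = fderiv ℝ G (y t) e w v := by
    intro e v w
    rw [← fderiv_apply_apply_const hG, ← fderiv_apply_apply_const hG]
    exact congrArg (fun L : E →L[ℝ] ℝ => L e)
      (Filter.EventuallyEq.fderiv_eq (hsymm.mono fun z hz => hz v w))
  -- In the sum of the Koszul formulas for (y', a; b) and (y', b; a) the terms differentiated along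
  -- a and b cancel, leaving twice the derivative of G along y'.
  have h1 := hΓ (deriv y t) (a t) (b t)
  have h2 := hΓ (deriv y t) (b t) (a t)
  rw [hDs (deriv y t) (b t) (a t), hDs (a t)] at h2
  rw [hDs (b t)] at h1
  rw [map_add, map_add, hsymm.self_of_nhds (a t) (Γ _ _)]
  simp only [Function.comp_apply, add_apply]
  rw [hDs (b t)] at h2
  linarith [hDs (a t) (deriv y t) (b t), hDs (b t) (deriv y t) (a t)]

end Calculus

/-! ### Linear algebra on ℝⁿ and smoothness of matrix inversion -/

section LinearAlgebra

variable {n : ℕ}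

lemma sum_stdVec (a : Rn n) : ∑ i, a i • stdVec n i = a := by
  ext j
  simp [stdVec, Finset.sum_apply, Pi.single_apply]

lemma ext_stdVec {F : Type*} [AddCommMonoid F] [Module ℝ F] [TopologicalSpace F]
    {L L' : Rn n →L[ℝ] F} (h : ∀ i, L (stdVec n i) = L' (stdVec n i)) : L = L' := by
  ext a
  rw [← sum_stdVec a]
  simp [h]

lemma stdVec_apply (i j : Fin n) : stdVec n i j = if j = i then 1 else 0 := by
  simp [stdVec]

lemma contDiffAt_det {E : Type*} [NormedAddCommGroup E] [NormedSpace ℝ E]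
    {A : E → Matrix (Fin n) (Fin n) ℝ} {z : E}
    (hA : ∀ i j, ContDiffAt ℝ ∞ (fun y => A y i j) z) :
    ContDiffAt ℝ ∞ (fun y => (A y).det) z := by
  simp only [Matrix.det_apply]
  exact ContDiffAt.sum fun σ _ => (contDiffAt_prod fun i _ => hA _ _).const_smul _

/-- Cramer's rule: an entry of the inverse is a determinant, polynomial in the entries, divided by
det A. -/
lemma contDiffAt_matrix_inv {E : Type*} [NormedAddCommGroup E] [NormedSpace ℝ E]
    {A : E → Matrix (Fin n) (Fin n) ℝ} {z : E}
    (hA : ∀ i j, ContDiffAt ℝ ∞ (fun y => A y i j) z) (hz : (A z).det ≠ 0) (i j : Fin n) :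
    ContDiffAt ℝ ∞ (fun y => (A y)⁻¹ i j) z := by
  simp only [Matrix.inv_def, Ring.inverse_eq_inv', Matrix.smul_apply, Matrix.adjugate_apply,
    smul_eq_mul]
  refine ((contDiffAt_det hA).inv hz).mul (contDiffAt_det fun k l => ?_)
  simp only [Matrix.updateRow_apply]
  split_ifs
  · exact contDiffAt_const
  · exact hA k l

end LinearAlgebra

/-! ### The metric and its Christoffel symbols in one chart -/

section Metric

variable {n : ℕ} {M : Type*} [TopologicalSpace M] [ChartedSpace (Rn n) M]
  [IsManifold (𝓡 n) ∞ M] [RiemannianBundle (fun x : M => TangentSpace (𝓡 n) x)]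

/-- The metric in the chart at `c`, as a bilinear form on `ℝⁿ` depending on the point `z`. -/
def metricForm (c : M) (z : Rn n) : Rn n →L[ℝ] Rn n →L[ℝ] ℝ :=
  ∑ i, ∑ j, metricMatrix c z i j • (EuclideanSpace.proj i : Rn n →L[ℝ] ℝ).smulRight
    (EuclideanSpace.proj j : Rn n →L[ℝ] ℝ)

/-- The bilinear map `christoffelMap c y`, bundled. -/
def christoffelL (c : M) (y : Rn n) : Rn n →L[ℝ] Rn n →L[ℝ] Rn n :=
  ∑ k, ∑ i, ∑ j, christoffel c y k i j • (EuclideanSpace.proj i : Rn n →L[ℝ] ℝ).smulRight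
    ((EuclideanSpace.proj j : Rn n →L[ℝ] ℝ).smulRight (stdVec n k))

lemma christoffelL_apply (c : M) (y a b : Rn n) :
    christoffelL c y a b = christoffelMap c y a b := by
  simp only [christoffelL, christoffelMap, sum_apply,
    smul_apply, ContinuousLinearMap.smulRight_apply, Finset.sum_smul,
    smul_smul]
  simp only [mul_assoc]
  rfl

lemma christoffelL_stdVec (c : M) (y : Rn n) (i j : Fin n) :
    christoffelL c y (stdVec n i) (stdVec n j) = ∑ k, christoffel c y k i j • stdVec n k := by
  simp [christoffelL_apply, christoffelMap, stdVec_apply]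

lemma metricForm_stdVec (c : M) (z : Rn n) (i j : Fin n) :
    metricForm c z (stdVec n i) (stdVec n j) = metricMatrix c z i j := by
  simp [metricForm, stdVec_apply]

lemma metricForm_eq_inner {c : M} {z : Rn n} (hz : z ∈ (extChartAt (𝓡 n) c).target) (a b : Rn n) :
    metricForm c z a b = inner ℝ (ofCoords c ((extChartAt (𝓡 n) c).symm z) a)
      (ofCoords c ((extChartAt (𝓡 n) c).symm z) b) := by
  have hs := symm_mem_source hz
  have h : ∀ a : Rn n, ofCoords c ((extChartAt (𝓡 n) c).symm z) a =
      ∑ i, a i • ofCoords c ((extChartAt (𝓡 n) c).symm z) (stdVec n i) := by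
    intro a
    simp only [← ofCoordsL_apply hs]
    conv_lhs => rw [← sum_stdVec a]
    rw [map_sum]
    exact Finset.sum_congr rfl fun i _ => map_smul _ _ _
  rw [h a, h b, sum_inner]
  simp only [inner_sum, real_inner_smul_left, real_inner_smul_right, metricForm, sum_apply,
    smul_apply, ContinuousLinearMap.smulRight_apply, smul_eq_mul]
  refine Finset.sum_congr rfl fun i _ => Finset.sum_congr rfl fun j _ => ?_
  have hp : ∀ (k : Fin n) (w : Rn n), (EuclideanSpace.proj k : Rn n →L[ℝ] ℝ) w = w k :=
    fun _ _ => rfl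
  rw [metricMatrix, hp, hp]
  ring

lemma metricForm_comm {c : M} {z : Rn n} (hz : z ∈ (extChartAt (𝓡 n) c).target) (a b : Rn n) :
    metricForm c z a b = metricForm c z b a := by
  rw [metricForm_eq_inner hz, metricForm_eq_inner hz, real_inner_comm]

lemma metricForm_self_eq_zero {c : M} {z : Rn n} (hz : z ∈ (extChartAt (𝓡 n) c).target) {a : Rn n}
    (h : metricForm c z a a = 0) : a = 0 := by
  rw [metricForm_eq_inner hz, inner_self_eq_zero] at h
  rw [← coords_ofCoords (symm_mem_source hz) a, h, ← coordsL_apply (symm_mem_source hz), map_zero]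

lemma metricForm_ext {c : M} {z : Rn n} (hz : z ∈ (extChartAt (𝓡 n) c).target) {a b : Rn n}
    (h : ∀ w, metricForm c z a w = metricForm c z b w) : a = b := by
  rw [← sub_eq_zero]
  apply metricForm_self_eq_zero hz
  have h' := h (a - b)
  simp only [map_sub, sub_apply] at h' ⊢
  linarith

/-- A kernel vector of the matrix would have length zero. -/
lemma det_metricMatrix_ne_zero {c : M} {z : Rn n} (hz : z ∈ (extChartAt (𝓡 n) c).target) :
    (metricMatrix c z).det ≠ 0 := by
  intro h
  obtain ⟨v, hv, hv0⟩ := Matrix.exists_mulVec_eq_zero_iff.2 h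
  apply hv
  have : WithLp.toLp 2 v = (0 : Rn n) := by
    apply metricForm_self_eq_zero hz
    have h2 : ∀ i, ∑ j, metricMatrix c z i j * v j = 0 := fun i => congrFun hv0 i
    simp only [metricForm, sum_apply, smul_apply,
      ContinuousLinearMap.smulRight_apply, smul_eq_mul]
    refine Finset.sum_eq_zero fun i _ => ?_
    calc _ = v i * ∑ j, metricMatrix c z i j * v j := by
          rw [Finset.mul_sum]; exact Finset.sum_congr rfl fun j _ => by
            change _ * (v i * v j) = _; ring
      _ = 0 := by rw [h2, mul_zero]
  ext i
  exact congrFun (congrArg WithLp.ofLp this) i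

variable [IsContMDiffRiemannianBundle (𝓡 n) ∞ (Rn n) (fun x : M => TangentSpace (𝓡 n) x)]

/-- The entries are inner products of coordinate vector fields, which are smooth sections of TM. -/
lemma contDiffAt_metricMatrix {c : M} {z : Rn n} (hz : z ∈ (extChartAt (𝓡 n) c).target)
    (i j : Fin n) : ContDiffAt ℝ ∞ (fun y => metricMatrix c y i j) z := by
  have key : ∀ i : Fin n, ContMDiffAt 𝓘(ℝ, Rn n) (𝓡 n).tangent ∞
      (fun y : Rn n => (⟨(extChartAt (𝓡 n) c).symm y,
        ofCoords c ((extChartAt (𝓡 n) c).symm y) (stdVec n i)⟩ : TangentBundle (𝓡 n) M)) z := by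
    intro i
    have hf : ContMDiffAt 𝓘(ℝ, Rn n) 𝓘(ℝ, Rn n × Rn n) ∞ (fun y : Rn n => (y, stdVec n i)) z :=
      (contDiff_id.prodMk contDiff_const).contMDiff.contMDiffAt
    exact ContMDiffAt.comp z (contMDiffAt_ofCoords (c := c) (q := (z, stdVec n i)) hz) hf
  exact ((key i).inner_bundle (key j)).contDiffAt

lemma contDiffAt_metricForm {c : M} {z : Rn n} (hz : z ∈ (extChartAt (𝓡 n) c).target) :
    ContDiffAt ℝ ∞ (metricForm c) z := by
  unfold metricForm
  exact ContDiffAt.sum fun i _ => ContDiffAt.sum fun j _ =>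
    contDiffAt_smul_const (contDiffAt_metricMatrix hz i j) _

lemma hasFDerivAt_metricForm {c : M} {z : Rn n} (hz : z ∈ (extChartAt (𝓡 n) c).target) :
    HasFDerivAt (metricForm c) (fderiv ℝ (metricForm c) z) z :=
  ((contDiffAt_metricForm hz).differentiableAt (by simp)).hasFDerivAt

lemma metricPartial_eq {c : M} {z : Rn n} (hz : z ∈ (extChartAt (𝓡 n) c).target)
    (l i j : Fin n) :
    metricPartial c z l i j =
      fderiv ℝ (metricForm c) z (stdVec n l) (stdVec n i) (stdVec n j) := by
  rw [← fderiv_apply_apply_const (hasFDerivAt_metricForm hz).differentiableAt, metricPartial]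
  simp only [metricForm_stdVec]

/-- The Koszul formula, in coordinates. -/
lemma metricForm_christoffelL {c : M} {z : Rn n} (hz : z ∈ (extChartAt (𝓡 n) c).target)
    (a b w : Rn n) :
    2 * metricForm c z (christoffelL c z a b) w =
      fderiv ℝ (metricForm c) z a b w + fderiv ℝ (metricForm c) z b a w -
        fderiv ℝ (metricForm c) z w a b := by
  -- By trilinearity only basis vectors matter; there, pairing with g cancels the g⁻¹ in the
  -- definition of `christoffel`.
  refine koszul_of_span (e := stdVec n) ?_ (fun i j m => ?_) a b w
  · rw [eq_top_iff]
    intro a _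
    rw [← sum_stdVec a]
    exact Submodule.sum_mem _ fun i _ =>
      Submodule.smul_mem _ _ (Submodule.subset_span (mem_range_self i))
  rw [← metricPartial_eq hz, ← metricPartial_eq hz, ← metricPartial_eq hz, christoffelL_stdVec]
  simp only [map_sum, map_smul, sum_apply, smul_apply,
    metricForm_stdVec, smul_eq_mul, christoffel]
  set K : Fin n → ℝ := fun l => metricPartial c z i j l + metricPartial c z j i l -
    metricPartial c z l i j
  have hinv : metricMatrix c z * (metricMatrix c z)⁻¹ = 1 :=
    Matrix.mul_nonsing_inv _ (det_metricMatrix_ne_zero hz).isUnit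
  have hsym : ∀ k, metricMatrix c z k m = metricMatrix c z m k := fun k => by
    rw [← metricForm_stdVec, ← metricForm_stdVec, metricForm_comm hz]
  calc 2 * ∑ k, (1 / 2 * ∑ l, (metricMatrix c z)⁻¹ k l * K l) * metricMatrix c z k m
      = ∑ k, ∑ l, metricMatrix c z m k * (metricMatrix c z)⁻¹ k l * K l := by
        rw [Finset.mul_sum]
        refine Finset.sum_congr rfl fun k _ => ?_
        rw [hsym, ← mul_assoc, ← mul_assoc, Finset.mul_sum, Finset.sum_mul]
        exact Finset.sum_congr rfl fun l _ => by ring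
    _ = ∑ l, (metricMatrix c z * (metricMatrix c z)⁻¹) m l * K l := by
        rw [Finset.sum_comm]
        simp only [Matrix.mul_apply, Finset.sum_mul]
    _ = K m := by simp [hinv, Matrix.one_apply]

lemma contDiffAt_christoffelL {c : M} {z : Rn n} (hz : z ∈ (extChartAt (𝓡 n) c).target) :
    ContDiffAt ℝ ∞ (christoffelL c) z := by
  have hp : ∀ l i j, ContDiffAt ℝ ∞ (fun y => metricPartial c y l i j) z := fun l i j =>
    ((contDiffAt_metricMatrix hz i j).fderiv_right (m := ∞) (by simp)).clm_apply contDiffAt_const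
  unfold christoffelL
  refine ContDiffAt.sum fun k _ => ContDiffAt.sum fun i _ => ContDiffAt.sum fun j _ =>
    contDiffAt_smul_const (contDiffAt_const.mul (ContDiffAt.sum fun l _ => ?_)) _
  exact (contDiffAt_matrix_inv (contDiffAt_metricMatrix hz) (det_metricMatrix_ne_zero hz) k l).mul
    (((hp _ _ _).add (hp _ _ _)).sub (hp _ _ _))

end Metric

/-! ### Change of chart; chart independence of the covariant derivative -/

section Transition

variable {n : ℕ} {M : Type*} [TopologicalSpace M] [ChartedSpace (Rn n) M]

/-- The change of coordinates from the chart at `c` to the chart at `c'`. -/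
def transition (c c' : M) (z : Rn n) : Rn n :=
  extChartAt (𝓡 n) c' ((extChartAt (𝓡 n) c).symm z)

lemma transition_extChartAt {c c' p : M} (hp : p ∈ (chartAt (Rn n) c).source) :
    transition c c' (extChartAt (𝓡 n) c p) = extChartAt (𝓡 n) c' p := by
  rw [transition, symm_extChartAt hp]

variable [IsManifold (𝓡 n) ∞ M]

lemma contDiffAt_transition {c c' p : M} (hp : p ∈ (chartAt (Rn n) c).source)
    (hp' : p ∈ (chartAt (Rn n) c').source) :
    ContDiffAt ℝ ∞ (transition c c') (extChartAt (𝓡 n) c p) := by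
  have h1 : ContMDiffAt (𝓡 n) 𝓘(ℝ, Rn n) ∞ (extChartAt (𝓡 n) c')
      ((extChartAt (𝓡 n) c).symm (extChartAt (𝓡 n) c p)) := by
    rw [symm_extChartAt hp]
    exact contMDiffAt_extChartAt' hp'
  exact (h1.comp _ (contMDiffAt_chart_symm (extChartAt_mem_target hp))).contDiffAt

lemma coords_eq_fderiv_transition {c c' p : M} (hp : p ∈ (chartAt (Rn n) c).source)
    (hp' : p ∈ (chartAt (Rn n) c').source) (w : TangentSpace (𝓡 n) p) :
    coords c' p w = fderiv ℝ (transition c c') (extChartAt (𝓡 n) c p) (coords c p w) := by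
  have h1 : HasMFDerivAt 𝓘(ℝ, Rn n) 𝓘(ℝ, Rn n) (transition c c') (extChartAt (𝓡 n) c p)
      (fderiv ℝ (transition c c') (extChartAt (𝓡 n) c p)) :=
    ((contDiffAt_transition hp hp').differentiableAt (by simp)).hasFDerivAt.hasMFDerivAt
  have h2 := h1.comp p (mdifferentiableAt_extChartAt (I := 𝓡 n) hp).hasMFDerivAt
  have h3 : extChartAt (𝓡 n) c' =ᶠ[𝓝 p] transition c c' ∘ extChartAt (𝓡 n) c := by
    filter_upwards [(chartAt (Rn n) c).open_source.mem_nhds hp] with q hq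
    exact (transition_extChartAt hq).symm
  rw [coords_eq_mfderiv hp', coords_eq_mfderiv hp, (h2.congr_of_eventuallyEq h3).mfderiv]
  rfl

lemma fderiv_transition_surjective {c c' p : M} (hp : p ∈ (chartAt (Rn n) c).source)
    (hp' : p ∈ (chartAt (Rn n) c').source) :
    Function.Surjective (fderiv ℝ (transition c c') (extChartAt (𝓡 n) c p)) := fun w =>
  ⟨coords c p (ofCoords c' p w), by
    rw [← coords_eq_fderiv_transition hp hp', coords_ofCoords hp']⟩

variable [RiemannianBundle (fun x : M => TangentSpace (𝓡 n) x)]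

lemma metricForm_eq_transition {c c' p : M} (hp : p ∈ (chartAt (Rn n) c).source)
    (hp' : p ∈ (chartAt (Rn n) c').source) (a b : Rn n) :
    metricForm c (extChartAt (𝓡 n) c p) a b =
      metricForm c' (transition c c' (extChartAt (𝓡 n) c p))
        (fderiv ℝ (transition c c') (extChartAt (𝓡 n) c p) a)
        (fderiv ℝ (transition c c') (extChartAt (𝓡 n) c p) b) := by
  have h : ∀ a, ofCoords c p a =
      ofCoords c' p (fderiv ℝ (transition c c') (extChartAt (𝓡 n) c p) a) := by
    intro a
    apply coords_injective hp'
    rw [coords_ofCoords hp', coords_eq_fderiv_transition hp hp', coords_ofCoords hp]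
  rw [transition_extChartAt hp, metricForm_eq_inner (extChartAt_mem_target hp),
    metricForm_eq_inner (extChartAt_mem_target hp'), symm_extChartAt hp, symm_extChartAt hp', h, h]

/-- A neighbourhood is needed because `christoffel_transform` differentiates this identity. -/
lemma eventually_metricForm_eq_transition {c c' p : M} (hp : p ∈ (chartAt (Rn n) c).source)
    (hp' : p ∈ (chartAt (Rn n) c').source) :
    ∀ᶠ y in 𝓝 (extChartAt (𝓡 n) c p), ∀ a b, metricForm c y a b =
      metricForm c' (transition c c' y)
        (fderiv ℝ (transition c c') y a) (fderiv ℝ (transition c c') y b) := by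
  have hc : ContinuousAt (extChartAt (𝓡 n) c).symm (extChartAt (𝓡 n) c p) :=
    (contMDiffAt_chart_symm (extChartAt_mem_target hp)).continuousAt
  have h1 := hc.preimage_mem_nhds (t := (chartAt (Rn n) c').source) (by
    rw [symm_extChartAt hp]; exact (chartAt (Rn n) c').open_source.mem_nhds hp')
  filter_upwards [h1, (isOpen_extChartAt_target c).mem_nhds (extChartAt_mem_target hp)]
    with y hy hy2 a b
  have := metricForm_eq_transition (symm_mem_source hy2) hy a b
  rwa [(extChartAt (𝓡 n) c).right_inv hy2] at this

variable [IsContMDiffRiemannianBundle (𝓡 n) ∞ (Rn n) (fun x : M => TangentSpace (𝓡 n) x)]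

lemma fderiv_transition_christoffelL {c c' p : M} (hp : p ∈ (chartAt (Rn n) c).source)
    (hp' : p ∈ (chartAt (Rn n) c').source) (a b : Rn n) :
    fderiv ℝ (transition c c') (extChartAt (𝓡 n) c p)
        (christoffelL c (extChartAt (𝓡 n) c p) a b) =
      christoffelL c' (extChartAt (𝓡 n) c' p)
        (fderiv ℝ (transition c c') (extChartAt (𝓡 n) c p) a)
        (fderiv ℝ (transition c c') (extChartAt (𝓡 n) c p) b) +
      fderiv ℝ (fderiv ℝ (transition c c')) (extChartAt (𝓡 n) c p) a b := by
  have ht := extChartAt_mem_target hp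
  have ht' : transition c c' (extChartAt (𝓡 n) c p) ∈ (extChartAt (𝓡 n) c').target := by
    rw [transition_extChartAt hp]
    exact extChartAt_mem_target hp'
  rw [← transition_extChartAt (c' := c') hp]
  exact christoffel_transform ((contDiffAt_transition hp hp').of_le (by norm_cast))
    (hasFDerivAt_metricForm ht').differentiableAt (hasFDerivAt_metricForm ht).differentiableAt
    (eventually_metricForm_eq_transition hp hp') (metricForm_comm ht')
    (fun a b h => metricForm_ext ht' h) (fderiv_transition_surjective hp hp')
    (metricForm_christoffelL ht) (metricForm_christoffelL ht') a b

/-- The covariant derivative along a curve may be computed in any chart. -/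
lemma covDerivAlong_eq {x : ℝ → M} {U : ∀ t, TangentSpace (𝓡 n) (x t)} {t : ℝ} {c : M}
    (hc : x t ∈ (chartAt (Rn n) c).source) (hx : ContinuousAt x t)
    (hy : DifferentiableAt ℝ (fun s => extChartAt (𝓡 n) c (x s)) t)
    (hU : DifferentiableAt ℝ (fun s => coords c (x s) (U s)) t) :
    covDerivAlong x U t = ofCoords c (x t) (deriv (fun s => coords c (x s) (U s)) t +
      christoffelL c (extChartAt (𝓡 n) c (x t)) (deriv (fun s => extChartAt (𝓡 n) c (x s)) t)
        (coords c (x t) (U t))) := by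
  have hc' : x t ∈ (chartAt (Rn n) (x t)).source := mem_chart_source _ _
  have e1 := hx.preimage_mem_nhds ((chartAt (Rn n) c).open_source.mem_nhds hc)
  have e2 := hx.preimage_mem_nhds ((chartAt (Rn n) (x t)).open_source.mem_nhds hc')
  have key := covariant_transform (φ := transition c (x t))
    (y := fun s => extChartAt (𝓡 n) c (x s)) (a := fun s => coords c (x s) (U s))
    (y₁ := fun s => extChartAt (𝓡 n) (x t) (x s)) (a₁ := fun s => coords (x t) (x s) (U s))
    (t := t) ((contDiffAt_transition hc hc').of_le (by norm_cast))
    (fderiv_transition_christoffelL hc hc') hy.hasDerivAt hU.hasDerivAt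
    (Filter.eventuallyEq_of_mem e1 fun s hs => (transition_extChartAt hs).symm)
    (by filter_upwards [e1, e2] with s hs hs' using coords_eq_fderiv_transition hs hs' _)
  rw [covDerivAlong, ← christoffelL_apply, key]
  apply coords_injective hc'
  rw [coords_ofCoords hc', coords_eq_fderiv_transition hc hc', coords_ofCoords hc]

/-- The Levi-Civita connection is compatible with the metric. -/
lemma hasDerivAt_inner {x : ℝ → M} {U W : ∀ t, TangentSpace (𝓡 n) (x t)} {t : ℝ}
    (hx : ContinuousAt x t)
    (hy : DifferentiableAt ℝ (fun s => extChartAt (𝓡 n) (x t) (x s)) t)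
    (hU : DifferentiableAt ℝ (fun s => coords (x t) (x s) (U s)) t)
    (hW : DifferentiableAt ℝ (fun s => coords (x t) (x s) (W s)) t) :
    HasDerivAt (fun s => inner ℝ (U s) (W s))
      (inner ℝ (covDerivAlong x U t) (W t) + inner ℝ (U t) (covDerivAlong x W t)) t := by
  have hc : x t ∈ (chartAt (Rn n) (x t)).source := mem_chart_source _ _
  have ht := extChartAt_mem_target hc
  have key : ∀ {s : ℝ}, x s ∈ (chartAt (Rn n) (x t)).source → ∀ v w : TangentSpace (𝓡 n) (x s),
      inner ℝ v w = metricForm (x t) (extChartAt (𝓡 n) (x t) (x s)) (coords (x t) (x s) v)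
        (coords (x t) (x s) w) := by
    intro s hs v w
    rw [metricForm_eq_inner (extChartAt_mem_target hs), symm_extChartAt hs, ofCoords_coords hs,
      ofCoords_coords hs]
  have h := hasDerivAt_metric (G := metricForm (x t))
    (y := fun s => extChartAt (𝓡 n) (x t) (x s)) (a := fun s => coords (x t) (x s) (U s))
    (b := fun s => coords (x t) (x s) (W s)) (t := t)
    (hasFDerivAt_metricForm ht).differentiableAt
    (Filter.eventually_of_mem ((isOpen_extChartAt_target (x t)).mem_nhds ht)
      fun z hz => metricForm_comm hz) (metricForm_christoffelL ht) hy hU hW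
  have h2 := h.congr_of_eventuallyEq (f₁ := fun s => inner ℝ (U s) (W s))
    (Filter.eventuallyEq_of_mem
      (hx.preimage_mem_nhds ((chartAt (Rn n) (x t)).open_source.mem_nhds hc))
      fun s hs => key hs _ _)
  refine h2.congr_deriv ?_
  rw [key hc, key hc, covDerivAlong, covDerivAlong, coords_ofCoords hc, coords_ofCoords hc,
    christoffelL_apply, christoffelL_apply]

end Transition

/-! ### The bundle Hom(ℝⁿ, TM) and its horizontal vectors -/

section HomBundle

variable {n : ℕ} {M : Type*} [TopologicalSpace M] [ChartedSpace (Rn n) M]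
  [IsManifold (𝓡 n) ∞ M]

variable (n) in
/-- The trivialization of `Hom(ℝⁿ, TM)` given by the chart at `c`. -/
def homTriv (c : M) : Trivialization (Rn n →L[ℝ] Rn n)
    (π (Rn n →L[ℝ] Rn n) (fun x : M => Bundle.Trivial M (Rn n) x →L[ℝ] TangentSpace (𝓡 n) x)) :=
  trivializationAt (Rn n →L[ℝ] Rn n)
    (fun x : M => Bundle.Trivial M (Rn n) x →L[ℝ] TangentSpace (𝓡 n) x) c

instance (c : M) : MemTrivializationAtlas (homTriv n c) :=
  inferInstanceAs (MemTrivializationAtlas (trivializationAt (Rn n →L[ℝ] Rn n)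
    (fun x : M => Bundle.Trivial M (Rn n) x →L[ℝ] TangentSpace (𝓡 n) x) c))

/-- The matrix of a linear map `u : ℝⁿ → T_x M` in the coordinate frame of the chart at `c`. -/
def homCoords (c : M) (u : HomBundle n M) : Rn n →L[ℝ] Rn n := (homTriv n c u).2

lemma mem_homTriv_source {c : M} {u : HomBundle n M} :
    u ∈ (homTriv n c).source ↔ u.proj ∈ (chartAt (Rn n) c).source := by
  rw [Trivialization.mem_source, homTriv, hom_trivializationAt_baseSet]
  simp

lemma homCoords_apply {c : M} {u : HomBundle n M} (hu : u.proj ∈ (chartAt (Rn n) c).source)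
    (w : Rn n) : homCoords c u w = coords c u.proj (app u w) := by
  rw [← coordsL_apply hu, homCoords, homTriv, hom_trivializationAt_apply]
  simp [ContinuousLinearMap.inCoordinates, app, coordsL]

/-- The linear map `ℝⁿ → T_x M` with matrix `A` in the coordinate frame of the chart at `c`. -/
def ofHomCoords (c x : M) (A : Rn n →L[ℝ] Rn n) : HomBundle n M :=
  (homTriv n c).toOpenPartialHomeomorph.symm (x, A)

lemma mem_homTriv_target {c x : M} (hx : x ∈ (chartAt (Rn n) c).source) (A : Rn n →L[ℝ] Rn n) :
    (x, A) ∈ (homTriv n c).target := by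
  rw [Trivialization.mem_target, homTriv, hom_trivializationAt_baseSet]
  simpa using hx

lemma ofHomCoords_proj {c x : M} (hx : x ∈ (chartAt (Rn n) c).source) (A : Rn n →L[ℝ] Rn n) :
    (ofHomCoords c x A).proj = x :=
  (homTriv n c).proj_symm_apply (mem_homTriv_target hx A)

lemma homCoords_ofHomCoords {c x : M} (hx : x ∈ (chartAt (Rn n) c).source)
    (A : Rn n →L[ℝ] Rn n) : homCoords c (ofHomCoords c x A) = A := by
  rw [homCoords, ofHomCoords, (homTriv n c).apply_symm_apply (mem_homTriv_target hx A)]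

lemma ofHomCoords_homCoords {c : M} {u : HomBundle n M}
    (hu : u.proj ∈ (chartAt (Rn n) c).source) : ofHomCoords c u.proj (homCoords c u) = u := by
  have hs := mem_homTriv_source.2 hu
  have h : (u.proj, homCoords c u) = homTriv n c u :=
    Prod.ext ((homTriv n c).coe_fst hs).symm rfl
  rw [ofHomCoords, h]
  exact (homTriv n c).toOpenPartialHomeomorph.left_inv hs

section Total

variable {F : Type*} [NormedAddCommGroup F] [NormedSpace ℝ F] {K : Type*} [TopologicalSpace K]
  {J : ModelWithCorners ℝ F K} {P : Type*} [TopologicalSpace P] [ChartedSpace K P]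

lemma contMDiffAt_hom_iff {f : P → HomBundle n M} {q : P} {c : M}
    (hq : (f q).proj ∈ (chartAt (Rn n) c).source) :
    ContMDiffAt J (homModel n) ∞ f q ↔ ContMDiffAt J (𝓡 n) ∞ (fun r => (f r).proj) q ∧
      ContMDiffAt J 𝓘(ℝ, Rn n →L[ℝ] Rn n) ∞ (fun r => homCoords c (f r)) q :=
  (homTriv n c).contMDiffAt_iff (mem_homTriv_source.2 hq)

end Total

lemma contMDiffAt_homProj (u : HomBundle n M) :
    ContMDiffAt (homModel n) (𝓡 n) ∞ (fun q : HomBundle n M => q.proj) u :=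
  contMDiffAt_proj _

lemma contMDiffAt_homCoords {c : M} {u : HomBundle n M}
    (hu : u.proj ∈ (chartAt (Rn n) c).source) :
    ContMDiffAt (homModel n) 𝓘(ℝ, Rn n →L[ℝ] Rn n) ∞ (homCoords c) u :=
  ((contMDiffAt_hom_iff (f := id) hu).1 contMDiffAt_id).2

lemma contMDiffAt_homChart {c : M} {u : HomBundle n M}
    (hu : u.proj ∈ (chartAt (Rn n) c).source) :
    ContMDiffAt (homModel n) 𝓘(ℝ, Rn n) ∞
      (fun q : HomBundle n M => extChartAt (𝓡 n) c q.proj) u :=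
  (contMDiffAt_extChartAt' hu).comp u (contMDiffAt_homProj u)

lemma continuousAt_homProj (u : HomBundle n M) :
    ContinuousAt (fun q : HomBundle n M => q.proj) u :=
  (contMDiffAt_homProj u).continuousAt

lemma eventually_coords_evalAt {c : M} {u : HomBundle n M}
    (hu : u.proj ∈ (chartAt (Rn n) c).source) (w : Rn n) :
    (fun q : HomBundle n M => coords c q.proj (app q w)) =ᶠ[𝓝 u] fun q => homCoords c q w := by
  filter_upwards [(continuousAt_homProj u).preimage_mem_nhds
    ((chartAt (Rn n) c).open_source.mem_nhds hu)] with q hq using (homCoords_apply hq w).symm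

lemma contMDiffAt_evalAt (w : Rn n) (u : HomBundle n M) :
    ContMDiffAt (homModel n) (𝓡 n).tangent ∞ (evalAt (M := M) w) u := by
  have hu : u.proj ∈ (chartAt (Rn n) u.proj).source := mem_chart_source _ _
  rw [contMDiffAt_tangent_iff (c := u.proj) hu]
  refine ⟨contMDiffAt_homProj u, ?_⟩
  have h : ContMDiffAt (homModel n) 𝓘(ℝ, Rn n) ∞ (fun q => homCoords u.proj q w) u :=
    (contMDiffAt_homCoords hu).clm_apply contMDiffAt_const
  exact h.congr_of_eventuallyEq (eventually_coords_evalAt hu w)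

/-- The base component of a tangent vector of `Hom(ℝⁿ, TM)` in the chart at its base point. -/
def dBase (u : HomBundle n M) (ξ : TangentSpace (homModel n) u) : Rn n :=
  mfderiv (homModel n) 𝓘(ℝ, Rn n)
    (fun q : HomBundle n M => extChartAt (𝓡 n) u.proj q.proj) u ξ

/-- The fibre component of a tangent vector of `Hom(ℝⁿ, TM)` in the chart at its base point. -/
def dFrame (u : HomBundle n M) (ξ : TangentSpace (homModel n) u) : Rn n →L[ℝ] Rn n :=
  mfderiv (homModel n) 𝓘(ℝ, Rn n →L[ℝ] Rn n) (homCoords u.proj) u ξ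

lemma mdifferentiableAt_homChart (u : HomBundle n M) :
    MDifferentiableAt (homModel n) 𝓘(ℝ, Rn n)
      (fun q : HomBundle n M => extChartAt (𝓡 n) u.proj q.proj) u :=
  (contMDiffAt_homChart (mem_chart_source _ _)).mdifferentiableAt (by simp)

lemma mdifferentiableAt_homCoords (u : HomBundle n M) :
    MDifferentiableAt (homModel n) 𝓘(ℝ, Rn n →L[ℝ] Rn n) (homCoords u.proj) u :=
  (contMDiffAt_homCoords (mem_chart_source _ _)).mdifferentiableAt (by simp)

/-- The extended chart of the total space at u is the pair (chart of the base point, `homCoords`),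
and its differential at u is injective. -/
lemma homTangent_ext {u : HomBundle n M} {ξ ξ' : TangentSpace (homModel n) u}
    (h : dBase u ξ = dBase u ξ') (h' : dFrame u ξ = dFrame u ξ') : ξ = ξ' := by
  have hinj : Function.Injective (mfderiv (homModel n) 𝓘(ℝ, Rn n × (Rn n →L[ℝ] Rn n))
      (extChartAt (homModel n) u) u) :=
    (isInvertible_mfderiv_extChartAt (mem_extChartAt_source u)).injective
  apply hinj
  have heq : (extChartAt (homModel n) u : HomBundle n M → Rn n × (Rn n →L[ℝ] Rn n)) =
      fun q => (extChartAt (𝓡 n) u.proj q.proj, homCoords u.proj q) := by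
    rw [FiberBundle.extChartAt]; rfl
  rw [heq]
  have hf := (mdifferentiableAt_homChart u).hasMFDerivAt
  have hg := (mdifferentiableAt_homCoords u).hasMFDerivAt
  have hp : HasMFDerivAt (homModel n) 𝓘(ℝ, Rn n × (Rn n →L[ℝ] Rn n))
      (fun q : HomBundle n M => (extChartAt (𝓡 n) u.proj q.proj, homCoords u.proj q)) u
      (ContinuousLinearMap.prod (mfderiv (homModel n) 𝓘(ℝ, Rn n)
        (fun q : HomBundle n M => extChartAt (𝓡 n) u.proj q.proj) u)
        (mfderiv (homModel n) 𝓘(ℝ, Rn n →L[ℝ] Rn n) (homCoords u.proj) u)) :=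
    ⟨hf.1.prodMk hg.1, hf.2.prodMk hg.2⟩
  rw [hp.mfderiv]
  exact Prod.ext h h'

lemma mfderiv_homProj (u : HomBundle n M) (ξ : TangentSpace (homModel n) u) :
    dBase u ξ = coords u.proj u.proj
      (mfderiv (homModel n) (𝓡 n) (fun q : HomBundle n M => q.proj) u ξ) := by
  have hu : u.proj ∈ (chartAt (Rn n) u.proj).source := mem_chart_source _ _
  rw [coords_eq_mfderiv hu]
  have h := (mdifferentiableAt_extChartAt (I := 𝓡 n) hu).hasMFDerivAt.comp u
    ((contMDiffAt_homProj u).mdifferentiableAt (by simp)).hasMFDerivAt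
  have h' := h.mfderiv
  exact congrArg (fun L => L ξ) h'

lemma hasDerivAt_homChart {γ : ℝ → HomBundle n M} {t : ℝ}
    (hγ : MDifferentiableAt 𝓘(ℝ, ℝ) (homModel n) γ t) :
    HasDerivAt (fun s => extChartAt (𝓡 n) (γ t).proj (γ s).proj)
      (dBase (γ t) (velocity (homModel n) γ t)) t :=
  hasDerivAt_of_hasMFDerivAt
    ((mdifferentiableAt_homChart (γ t)).hasMFDerivAt.comp t hγ.hasMFDerivAt)

lemma hasDerivAt_homCoords {γ : ℝ → HomBundle n M} {t : ℝ}
    (hγ : MDifferentiableAt 𝓘(ℝ, ℝ) (homModel n) γ t) :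
    HasDerivAt (fun s => homCoords (γ t).proj (γ s))
      (dFrame (γ t) (velocity (homModel n) γ t)) t :=
  hasDerivAt_of_hasMFDerivAt
    ((mdifferentiableAt_homCoords (γ t)).hasMFDerivAt.comp t hγ.hasMFDerivAt)

variable [RiemannianBundle (fun x : M => TangentSpace (𝓡 n) x)]

/-- Chain rule through u ↦ u(w). It turns horizontality into the linear equation dA w + Γ(dx, A w) =
0 for the matrix A of u. -/
lemma connector_evalAt (u : HomBundle n M) (ξ : TangentSpace (homModel n) u) (w : Rn n) :
    connector (evalAt w u) (mfderiv (homModel n) (𝓡 n).tangent (evalAt (M := M) w) u ξ) =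
      ofCoords u.proj u.proj (dFrame u ξ w + christoffelL u.proj (extChartAt (𝓡 n) u.proj u.proj)
        (dBase u ξ) (homCoords u.proj u w)) := by
  have hu : u.proj ∈ (chartAt (Rn n) u.proj).source := mem_chart_source _ _
  have he := ((contMDiffAt_evalAt w u).mdifferentiableAt (by simp)).hasMFDerivAt
  have h1 := (((contMDiffAt_chart_proj (evalAt w u) (c := u.proj) hu).mdifferentiableAt
    (by simp)).hasMFDerivAt.comp u he).mfderiv
  have h2 := (((contMDiffAt_coords (evalAt w u) (c := u.proj) hu).mdifferentiableAt
    (by simp)).hasMFDerivAt.comp u he).mfderiv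
  have h3 : mfderiv (homModel n) 𝓘(ℝ, Rn n) (fun q : HomBundle n M => coords u.proj q.proj
      (app q w)) u ξ = dFrame u ξ w := by
    have h4 : HasMFDerivAt (homModel n) 𝓘(ℝ, Rn n) (fun q : HomBundle n M => homCoords u.proj q w)
        u ((ContinuousLinearMap.apply ℝ (Rn n) w).comp
          (mfderiv (homModel n) 𝓘(ℝ, Rn n →L[ℝ] Rn n) (homCoords u.proj) u)) :=
      (ContinuousLinearMap.apply ℝ (Rn n) w).hasMFDerivAt.comp u
        (mdifferentiableAt_homCoords u).hasMFDerivAt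
    rw [(h4.congr_of_eventuallyEq (eventually_coords_evalAt hu w)).mfderiv]
    rfl
  rw [christoffelL_apply, homCoords_apply hu, ← h3]
  have h1' := congrArg (fun L => L ξ) h1
  have h2' := congrArg (fun L => L ξ) h2
  unfold connector
  exact congrArg₂ (fun (a b : Rn n) => ofCoords u.proj u.proj (b + christoffelMap u.proj
    (extChartAt (𝓡 n) u.proj u.proj) a (coords u.proj u.proj (app u w)))) h1'.symm h2'.symm

lemma isHorizontal_iff (u : HomBundle n M) (ξ : TangentSpace (homModel n) u) :
    IsHorizontal u ξ ↔ ∀ w, dFrame u ξ w + christoffelL u.proj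
      (extChartAt (𝓡 n) u.proj u.proj) (dBase u ξ) (homCoords u.proj u w) = 0 := by
  have hu : u.proj ∈ (chartAt (Rn n) u.proj).source := mem_chart_source _ _
  refine forall_congr' fun w => ?_
  rw [connector_evalAt]
  constructor
  · intro h
    apply ofCoords_injective hu
    rw [h, ← ofCoordsL_apply hu, map_zero]
    rfl
  · intro h
    rw [h, ← ofCoordsL_apply hu, map_zero]
    rfl

/-- The projection determines the base component, and the horizontality equation then determines the
frame component. -/
lemma horizontalLift_unique {u : HomBundle n M} {a : TangentSpace (𝓡 n) u.proj}
    {ξ ξ' : TangentSpace (homModel n) u} (h : IsHorizontalLift u a ξ)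
    (h' : IsHorizontalLift u a ξ') : ξ = ξ' := by
  have hb : dBase u ξ = dBase u ξ' := by rw [mfderiv_homProj, mfderiv_homProj, h.2.2, h'.2.2]
  refine homTangent_ext hb (ContinuousLinearMap.ext fun w => ?_)
  have h1 := (isHorizontal_iff u ξ).1 h.2.1 w
  have h2 := (isHorizontal_iff u ξ').1 h'.2.1 w
  rw [hb] at h1
  exact add_right_cancel (h1.trans h2.symm)

end HomBundle

/-! ### Smoothness, orthonormality and inverses of frames -/

section Frames

variable {n : ℕ} {M : Type*} [TopologicalSpace M] [ChartedSpace (Rn n) M]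
  [IsManifold (𝓡 n) ∞ M]

lemma app_sum (u : HomBundle n M) (w : Rn n) : app u w = ∑ i, w i • app u (stdVec n i) := by
  have h : u.snd w = ∑ i, w i • u.snd (stdVec n i) := by
    conv_lhs => rw [← sum_stdVec w]
    rw [map_sum]
    exact Finset.sum_congr rfl fun i _ => map_smul _ _ _
  exact h

lemma contMDiffAt_of_frame {τ : ℝ → HomBundle n M} {t : ℝ}
    (hτ : ContMDiffAt 𝓘(ℝ, ℝ) (𝓡 n) ∞ (fun s => (τ s).proj) t)
    (h : ∀ α, ContMDiffAt 𝓘(ℝ, ℝ) (𝓡 n).tangent ∞ (fun s => evalAt (stdVec n α) (τ s)) t) :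
    ContMDiffAt 𝓘(ℝ, ℝ) (homModel n) ∞ τ t := by
  have hc : (τ t).proj ∈ (chartAt (Rn n) (τ t).proj).source := mem_chart_source _ _
  rw [contMDiffAt_hom_iff hc]
  refine ⟨hτ, ?_⟩
  have hα : ∀ α, ContDiffAt ℝ ∞ (fun s => homCoords (τ t).proj (τ s) (stdVec n α)) t := by
    intro α
    have h1 := ((contMDiffAt_tangent_iff (c := (τ t).proj) hc).1 (h α)).2.contDiffAt
    refine h1.congr_of_eventuallyEq ?_
    filter_upwards [hτ.continuousAt.preimage_mem_nhds
      ((chartAt (Rn n) (τ t).proj).open_source.mem_nhds hc)] with s hs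
    exact homCoords_apply hs _
  -- The matrix is the sum over α of its α-th column times the α-th coordinate functional, so smooth
  -- columns give a smooth matrix.
  have hsum : (fun s => homCoords (τ t).proj (τ s)) = fun s => ∑ α,
      ContinuousLinearMap.smulRightL ℝ (Rn n) (Rn n) (EuclideanSpace.proj α)
        (homCoords (τ t).proj (τ s) (stdVec n α)) := by
    funext s
    refine ContinuousLinearMap.ext fun w => ?_
    rw [sum_apply]
    conv_lhs => rw [← sum_stdVec w, map_sum]
    exact Finset.sum_congr rfl fun i _ => map_smul _ _ _
  rw [hsum]
  exact (ContDiffAt.sum fun α _ =>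
    (ContinuousLinearMap.contDiff _).contDiffAt.comp t (hα α)).contMDiffAt

lemma contDiffAt_chartCurve {x : ℝ → M} {t : ℝ} {c : M} (hc : x t ∈ (chartAt (Rn n) c).source)
    (hx : ContMDiffAt 𝓘(ℝ, ℝ) (𝓡 n) ∞ x t) :
    ContDiffAt ℝ ∞ (fun s => extChartAt (𝓡 n) c (x s)) t :=
  ((contMDiffAt_chart_iff hx.continuousAt hc).1 hx).contDiffAt

lemma eventually_coords_velocity {x : ℝ → M} {t : ℝ} {c : M}
    (hc : x t ∈ (chartAt (Rn n) c).source) (hx : ContMDiffAt 𝓘(ℝ, ℝ) (𝓡 n) ∞ x t) :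
    (fun s => coords c (x s) (velocity (𝓡 n) x s)) =ᶠ[𝓝 t]
      deriv (fun s => extChartAt (𝓡 n) c (x s)) := by
  -- Smoothness of order ∞ at t provides, for each finite order, a neighbourhood depending on that
  -- order; order 1 is enough here.
  have h1 : ∀ᶠ s in 𝓝 t, ContMDiffAt 𝓘(ℝ, ℝ) (𝓡 n) 1 x s :=
    (contMDiffAt_iff_contMDiffAt_nhds (by simp)).1 (hx.of_le (by norm_cast))
  filter_upwards [h1, hx.continuousAt.preimage_mem_nhds
    ((chartAt (Rn n) c).open_source.mem_nhds hc)] with s hs hs'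
  exact (coords_velocity (hs.mdifferentiableAt (by simp)) hs').deriv.symm

lemma contDiffAt_coords_velocity {x : ℝ → M} {t : ℝ} {c : M}
    (hc : x t ∈ (chartAt (Rn n) c).source) (hx : ContMDiffAt 𝓘(ℝ, ℝ) (𝓡 n) ∞ x t) :
    ContDiffAt ℝ ∞ (fun s => coords c (x s) (velocity (𝓡 n) x s)) t := by
  have h : ContDiffAt ℝ ∞ (deriv fun s => extChartAt (𝓡 n) c (x s)) t :=
    ((contDiffAt_chartCurve hc hx).fderiv_right (m := ∞) (by simp)).clm_apply contDiffAt_const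
  exact h.congr_of_eventuallyEq (eventually_coords_velocity hc hx)

variable [RiemannianBundle (fun x : M => TangentSpace (𝓡 n) x)]

lemma mem_orthoFrames_iff {u : HomBundle n M} : u ∈ orthoFrames n M ↔
    ∀ i j, inner ℝ (app u (stdVec n i)) (app u (stdVec n j)) =
      inner ℝ (stdVec n i) (stdVec n j) := by
  refine ⟨fun h i j => h _ _, fun h w w' => ?_⟩
  rw [app_sum u w, app_sum u w', ← sum_stdVec w, ← sum_stdVec w', sum_inner, sum_inner]
  refine Finset.sum_congr rfl fun i _ => ?_
  rw [inner_sum, inner_sum]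
  refine Finset.sum_congr rfl fun j _ => ?_
  simp only [real_inner_smul_left, real_inner_smul_right, sum_stdVec, h]

/-- An inner-product-preserving map is injective, and the dimensions agree. -/
lemma isInvertible_homCoords {c : M} {u : HomBundle n M}
    (hu : u.proj ∈ (chartAt (Rn n) c).source) (ho : u ∈ orthoFrames n M) :
    (homCoords c u).IsInvertible := by
  have hinj : Function.Injective (homCoords c u : Rn n →ₗ[ℝ] Rn n) := by
    rw [← LinearMap.ker_eq_bot, LinearMap.ker_eq_bot']
    intro w hw
    have h1 : app u w = 0 := by
      apply coords_injective hu
      rw [← homCoords_apply hu, ← coordsL_apply hu, map_zero]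
      exact hw
    have h2 := ho w w
    rw [h1, inner_zero_left] at h2
    exact inner_self_eq_zero.1 h2.symm
  exact ⟨(LinearEquiv.ofInjectiveEndo _ hinj).toContinuousLinearEquiv, by ext; rfl⟩

/-- Replaces inversion between varying fibres by inversion in the fixed space of endomorphisms of
ℝⁿ, where it is smooth. -/
lemma invApp_eq {c : M} {u : HomBundle n M} (hu : u.proj ∈ (chartAt (Rn n) c).source)
    (ho : u ∈ orthoFrames n M) (a : TangentSpace (𝓡 n) u.proj) :
    invApp u a = (homCoords c u).inverse (coords c u.proj a) := by
  obtain ⟨e, he⟩ := isInvertible_homCoords hu ho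
  have hap : ∀ w, coordsL c u.proj (u.snd w) = e w := fun w => by
    rw [coordsL_apply hu, ← ContinuousLinearEquiv.coe_coe, he, homCoords_apply hu]
    rfl
  let g : TangentSpace (𝓡 n) u.proj →L[ℝ] Rn n := (e.symm : Rn n →L[ℝ] Rn n).comp (coordsL c u.proj)
  have h : ContinuousLinearMap.inverse u.snd = g := by
    apply ContinuousLinearMap.inverse_eq
    · ext a
      apply coords_injective hu
      rw [← coordsL_apply hu, ← coordsL_apply hu]
      exact (hap _).trans (e.apply_symm_apply _)
    · refine ContinuousLinearMap.ext fun w => ?_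
      exact (congrArg e.symm (hap w)).trans (e.symm_apply_apply w)
  rw [invApp, h, ← he, ContinuousLinearMap.inverse_equiv, ← coordsL_apply hu]
  rfl

end Frames

/-! ### Forced frame curves and their initial velocity -/

section Forced

variable {n : ℕ} {M : Type*} [TopologicalSpace M] [ChartedSpace (Rn n) M]
  [IsManifold (𝓡 n) ∞ M]

lemma eventually_proj_mem {τ : ℝ → HomBundle n M} {t : ℝ} {c : M}
    (hτ : ContinuousAt (fun s => (τ s).proj) t) (hc : (τ t).proj ∈ (chartAt (Rn n) c).source) :
    ∀ᶠ s in 𝓝 t, (τ s).proj ∈ (chartAt (Rn n) c).source :=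
  hτ.preimage_mem_nhds ((chartAt (Rn n) c).open_source.mem_nhds hc)

lemma contDiffAt_homCoords {τ : ℝ → HomBundle n M} {t : ℝ} {c : M}
    (hτ : ContMDiffAt 𝓘(ℝ, ℝ) (homModel n) ∞ τ t)
    (hc : (τ t).proj ∈ (chartAt (Rn n) c).source) :
    ContDiffAt ℝ ∞ (fun s => homCoords c (τ s)) t :=
  ((contMDiffAt_hom_iff hc).1 hτ).2.contDiffAt

lemma contDiffAt_coords_app {τ : ℝ → HomBundle n M} {t : ℝ} {c : M}
    (hτ : ContMDiffAt 𝓘(ℝ, ℝ) (homModel n) ∞ τ t)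
    (hc : (τ t).proj ∈ (chartAt (Rn n) c).source) (w : Rn n) :
    ContDiffAt ℝ ∞ (fun s => coords c (τ s).proj (app (τ s) w)) t := by
  have h : ContDiffAt ℝ ∞ (fun s => homCoords c (τ s) w) t :=
    (contDiffAt_homCoords hτ hc).clm_apply contDiffAt_const
  exact h.congr_of_eventuallyEq (hτ.continuousAt.eventually (eventually_coords_evalAt hc w))

variable [RiemannianBundle (fun x : M => TangentSpace (𝓡 n) x)]
  {V : ∀ x : M, TangentSpace (𝓡 n) x → TangentSpace (𝓡 n) x}
  {u : HomBundle n M} {v : Rn n} {ε : ℝ} {τ : ℝ → HomBundle n M} {vt : ℝ → Rn n}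

namespace IsForcedFrameCurve

lemma zero_mem (h : IsForcedFrameCurve V u v ε τ vt) : (0 : ℝ) ∈ Ioo (-ε) ε :=
  ⟨neg_lt_zero.2 h.pos, h.pos⟩

lemma contMDiffAt_proj (h : IsForcedFrameCurve V u v ε τ vt) {t : ℝ} (ht : t ∈ Ioo (-ε) ε) :
    ContMDiffAt 𝓘(ℝ, ℝ) (𝓡 n) ∞ (fun s => (τ s).proj) t :=
  h.smooth.contMDiffAt (isOpen_Ioo.mem_nhds ht)

lemma contMDiffAt (h : IsForcedFrameCurve V u v ε τ vt) {t : ℝ} (ht : t ∈ Ioo (-ε) ε) :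
    ContMDiffAt 𝓘(ℝ, ℝ) (homModel n) ∞ τ t :=
  contMDiffAt_of_frame (h.contMDiffAt_proj ht) fun α =>
    (h.smooth_frame α).contMDiffAt (isOpen_Ioo.mem_nhds ht)

lemma mdifferentiableAt (h : IsForcedFrameCurve V u v ε τ vt) {t : ℝ} (ht : t ∈ Ioo (-ε) ε) :
    MDifferentiableAt 𝓘(ℝ, ℝ) (homModel n) τ t :=
  (h.contMDiffAt ht).mdifferentiableAt (by simp)

/-- For w = e_α this is the parallel equation at time 0, where `covDerivAlong` already uses the
chart at the base point; linearity gives every w. -/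
lemma horizontal_equation (h : IsForcedFrameCurve V u v ε τ vt) (w : Rn n) :
    dFrame (τ 0) (velocity (homModel n) τ 0) w + christoffelL (τ 0).proj
      (extChartAt (𝓡 n) (τ 0).proj (τ 0).proj) (dBase (τ 0) (velocity (homModel n) τ 0))
        (homCoords (τ 0).proj (τ 0) w) = 0 := by
  have hc : (τ 0).proj ∈ (chartAt (Rn n) (τ 0).proj).source := mem_chart_source _ _
  have hm := h.mdifferentiableAt h.zero_mem
  have hbasis : dFrame (τ 0) (velocity (homModel n) τ 0) + (christoffelL (τ 0).proj
      (extChartAt (𝓡 n) (τ 0).proj (τ 0).proj) (dBase (τ 0) (velocity (homModel n) τ 0))).comp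
        (homCoords (τ 0).proj (τ 0)) = 0 := by
    refine ext_stdVec fun α => ?_
    have h1 := h.parallel α 0 h.zero_mem
    have h2 : HasDerivAt (fun s => coords (τ 0).proj (τ s).proj (app (τ s) (stdVec n α)))
        (dFrame (τ 0) (velocity (homModel n) τ 0) (stdVec n α)) 0 := by
      have h3 := (hasDerivAt_homCoords hm).clm_apply (hasDerivAt_const (0 : ℝ) (stdVec n α))
      rw [map_zero, add_zero] at h3
      exact h3.congr_of_eventuallyEq (hm.continuousAt.eventually (eventually_coords_evalAt hc _))
    rw [covDerivAlong, h2.deriv, (hasDerivAt_homChart hm).deriv, ← christoffelL_apply,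
      ← homCoords_apply hc] at h1
    have h4 := congrArg (coords (τ 0).proj (τ 0).proj) h1
    rw [coords_ofCoords hc, ← coordsL_apply hc, map_zero] at h4
    exact h4
  exact congrArg (fun L => L w) hbasis

lemma dBase_velocity (h : IsForcedFrameCurve V u v ε τ vt) :
    dBase (τ 0) (velocity (homModel n) τ 0) = homCoords (τ 0).proj (τ 0) v := by
  have hc : (τ 0).proj ∈ (chartAt (Rn n) (τ 0).proj).source := mem_chart_source _ _
  rw [homCoords_apply hc, ← h.init_velocity]
  exact (hasDerivAt_homChart (h.mdifferentiableAt h.zero_mem)).unique (coords_velocity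
    ((h.contMDiffAt_proj h.zero_mem).mdifferentiableAt (by simp)) hc)

section Orthonormal

variable [IsContMDiffRiemannianBundle (𝓡 n) ∞ (Rn n) (fun x : M => TangentSpace (𝓡 n) x)]

/-- Parallel transport preserves orthonormal frames. -/
lemma mem_orthoFrames (h : IsForcedFrameCurve V u v ε τ vt) (hu : u ∈ orthoFrames n M) {t : ℝ}
    (ht : t ∈ Ioo (-ε) ε) : τ t ∈ orthoFrames n M := by
  rw [mem_orthoFrames_iff]
  intro i j
  have hd : ∀ s ∈ Ioo (-ε) ε, HasDerivAt (fun r => (inner ℝ (app (τ r) (stdVec n i))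
      (app (τ r) (stdVec n j)) : ℝ)) 0 s := by
    intro s hs
    have hc : (τ s).proj ∈ (chartAt (Rn n) (τ s).proj).source := mem_chart_source _ _
    have hd := hasDerivAt_inner (x := fun r => (τ r).proj)
      (U := fun r => app (τ r) (stdVec n i)) (W := fun r => app (τ r) (stdVec n j)) (t := s)
      (h.contMDiffAt_proj hs).continuousAt
      ((contDiffAt_chartCurve hc (h.contMDiffAt_proj hs)).differentiableAt (by simp))
      ((contDiffAt_coords_app (h.contMDiffAt hs) hc _).differentiableAt (by simp))
      ((contDiffAt_coords_app (h.contMDiffAt hs) hc _).differentiableAt (by simp))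
    rw [h.parallel i s hs, h.parallel j s hs, inner_zero_left, inner_zero_right, add_zero] at hd
    exact hd
  have h1 := isOpen_Ioo.is_const_of_deriv_eq_zero isPreconnected_Ioo
    (fun s hs => (hd s hs).differentiableAt.differentiableWithinAt) (fun s hs => (hd s hs).deriv)
    ht h.zero_mem
  rw [h1, h.init]
  exact hu _ _

lemma eventually_vt (h : IsForcedFrameCurve V u v ε τ vt) (hu : u ∈ orthoFrames n M) {t : ℝ}
    (ht : t ∈ Ioo (-ε) ε) {c : M} (hc : (τ t).proj ∈ (chartAt (Rn n) c).source) :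
    vt =ᶠ[𝓝 t] fun s => (homCoords c (τ s)).inverse
      (coords c (τ s).proj (velocity (𝓡 n) (fun r => (τ r).proj) s)) := by
  filter_upwards [isOpen_Ioo.mem_nhds ht,
    eventually_proj_mem (h.contMDiffAt_proj ht).continuousAt hc] with s hs hs'
  rw [h.velocity_eq s hs]
  exact invApp_eq hs' (h.mem_orthoFrames hu hs) _

lemma contDiffAt_vt (h : IsForcedFrameCurve V u v ε τ vt) (hu : u ∈ orthoFrames n M) {t : ℝ}
    (ht : t ∈ Ioo (-ε) ε) : ContDiffAt ℝ ∞ vt t := by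
  have hc : (τ t).proj ∈ (chartAt (Rn n) (τ t).proj).source := mem_chart_source _ _
  refine ContDiffAt.congr_of_eventuallyEq ?_ (h.eventually_vt hu ht hc)
  obtain ⟨e, he⟩ := isInvertible_homCoords hc (h.mem_orthoFrames hu ht)
  have hinv : ContDiffAt ℝ ∞ ContinuousLinearMap.inverse (homCoords (τ t).proj (τ t)) := by
    rw [← he]
    exact contDiffAt_map_inverse e
  exact (hinv.comp t (contDiffAt_homCoords (h.contMDiffAt ht) hc)).clm_apply
    (contDiffAt_coords_velocity hc (h.contMDiffAt_proj ht))

lemma contMDiffAt_pair (h : IsForcedFrameCurve V u v ε τ vt) (hu : u ∈ orthoFrames n M) {t : ℝ}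
    (ht : t ∈ Ioo (-ε) ε) :
    ContMDiffAt 𝓘(ℝ, ℝ) (phaseModel n) ∞ (fun t => (τ t, vt t)) t :=
  (h.contMDiffAt ht).prodMk (h.contDiffAt_vt hu ht).contMDiffAt

lemma vt_zero (h : IsForcedFrameCurve V u v ε τ vt) (hu : u ∈ orthoFrames n M) : vt 0 = v := by
  have hc : (τ 0).proj ∈ (chartAt (Rn n) (τ 0).proj).source := mem_chart_source _ _
  have ho := h.mem_orthoFrames hu h.zero_mem
  rw [h.velocity_eq 0 h.zero_mem, h.init_velocity, invApp_eq hc ho, ← homCoords_apply hc]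
  obtain ⟨e, he⟩ := isInvertible_homCoords hc ho
  rw [← he, ContinuousLinearMap.inverse_equiv]
  exact e.symm_apply_apply v

/-- Tangency to F_O(M) is witnessed by τ itself, which stays orthonormal. -/
lemma isHorizontalLift (h : IsForcedFrameCurve V u v ε τ vt) (hu : u ∈ orthoFrames n M) :
    IsHorizontalLift (τ 0) (app (τ 0) v) (velocity (homModel n) τ 0) := by
  have hc : (τ 0).proj ∈ (chartAt (Rn n) (τ 0).proj).source := mem_chart_source _ _
  refine ⟨⟨ε, τ, h.pos, fun t ht => (h.contMDiffAt ht).contMDiffWithinAt,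
    fun t ht => h.mem_orthoFrames hu ht, h.mdifferentiableAt h.zero_mem, rfl⟩,
    (isHorizontal_iff _ _).2 h.horizontal_equation, ?_⟩
  apply coords_injective hc
  rw [← mfderiv_homProj, h.dBase_velocity, homCoords_apply hc]

/-- In coordinates x' = A v, so ∇x' = A v' + (A' v + Γ(x', A v)). The bracket vanishes because the
frame is parallel, and the geodesic equation then gives A v' = V. -/
lemma hasDerivAt_vt (h : IsForcedFrameCurve V u v ε τ vt) (hu : u ∈ orthoFrames n M) :
    HasDerivAt vt (invApp (τ 0) (V (τ 0).proj (app (τ 0) v))) 0 := by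
  have hc : (τ 0).proj ∈ (chartAt (Rn n) (τ 0).proj).source := mem_chart_source _ _
  have ho := h.mem_orthoFrames hu h.zero_mem
  have hm := h.mdifferentiableAt h.zero_mem
  have hx := h.contMDiffAt_proj h.zero_mem
  obtain ⟨e, he⟩ := isInvertible_homCoords hc ho
  have hvt : HasDerivAt vt (deriv vt 0) 0 :=
    ((h.contDiffAt_vt hu h.zero_mem).differentiableAt (by simp)).hasDerivAt
  have h1 := (hasDerivAt_homCoords hm).clm_apply hvt
  have h2 : (fun s => coords (τ 0).proj (τ s).proj (velocity (𝓡 n) (fun r => (τ r).proj) s))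
      =ᶠ[𝓝 0] fun s => homCoords (τ 0).proj (τ s) (vt s) := by
    filter_upwards [h.eventually_vt hu h.zero_mem hc, isOpen_Ioo.mem_nhds h.zero_mem,
      eventually_proj_mem hx.continuousAt hc] with s hs hs' hs''
    obtain ⟨e, he⟩ := isInvertible_homCoords hs'' (h.mem_orthoFrames hu hs')
    rw [hs, ← he, ContinuousLinearMap.inverse_equiv]
    exact (e.apply_symm_apply _).symm
  have h3 := h.geodesic 0 h.zero_mem
  rw [covDerivAlong, (h1.congr_of_eventuallyEq h2).deriv, (hasDerivAt_homChart hm).deriv,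
    ← christoffelL_apply, h.vt_zero hu, h.init_velocity, ← homCoords_apply hc] at h3
  have h4 := congrArg (coords (τ 0).proj (τ 0).proj) h3
  rw [coords_ofCoords hc, add_right_comm, h.horizontal_equation v, zero_add, ← he] at h4
  rw [invApp_eq hc ho, ← h4, ← he, ContinuousLinearMap.inverse_equiv]
  have h5 : (e.symm : Rn n →L[ℝ] Rn n) ((e : Rn n →L[ℝ] Rn n) (deriv vt 0)) = deriv vt 0 :=
    e.symm_apply_apply _
  rw [h5]
  exact hvt

lemma hasVelocityAt (h : IsForcedFrameCurve V u v ε τ vt) (hu : u ∈ orthoFrames n M) :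
    HasVelocityAt (phaseModel n) (fun t => (τ t, vt t)) 0 (u, v)
      (tangentPair (canonicalHorizontal v u) (invApp u (V u.proj (app u v)))) := by
  have hτ := h.mdifferentiableAt h.zero_mem
  have hvt := h.hasDerivAt_vt hu
  have hv0 := h.vt_zero hu
  have hl := h.isHorizontalLift hu
  have hinit := h.init
  have hmv : HasMFDerivAt 𝓘(ℝ, ℝ) 𝓘(ℝ, Rn n) vt 0 _ := hvt.hasFDerivAt.hasMFDerivAt
  have hp := hτ.hasMFDerivAt.prodMk hmv
  refine ⟨hp.mdifferentiableAt, ?_⟩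
  -- Identifies u with τ 0, so that the two tangent vectors live in the same type.
  subst hinit
  have hcan : canonicalHorizontal v (τ 0) = velocity (homModel n) τ 0 :=
    horizontalLift_unique (Classical.epsilon_spec ⟨_, hl⟩) hl
  have hvel : velocity (phaseModel n) (fun t => (τ t, vt t)) 0 =
      tangentPair (canonicalHorizontal v (τ 0)) (invApp (τ 0) (V (τ 0).proj (app (τ 0) v))) := by
    rw [hcan]
    have h1 := congrArg (fun L => L (1 : ℝ)) hp.mfderiv
    refine Eq.trans h1 (Prod.ext rfl ?_)
    exact one_smul ℝ _
  subst hv0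
  exact congrArg (TotalSpace.mk (τ 0, vt 0)) hvel

end Orthonormal

end IsForcedFrameCurve

end Forced

/-- Local solutions of a smooth autonomous differential equation exist and are smooth. -/
lemma exists_smooth_integralCurve {S : Type*} [NormedAddCommGroup S] [NormedSpace ℝ S]
    [CompleteSpace S] {f : S → S} {O : Set S} (hO : IsOpen O)
    (hf : ∀ z ∈ O, ContDiffAt ℝ ∞ f z) {z₀ : S} (hz : z₀ ∈ O) :
    ∃ (ε : ℝ) (γ : ℝ → S), 0 < ε ∧ γ 0 = z₀ ∧ ∀ t ∈ Ioo (-ε) ε,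
      γ t ∈ O ∧ HasDerivAt γ (f (γ t)) t ∧ ContDiffAt ℝ ∞ γ t := by
  obtain ⟨r, hr, ε, hε, h⟩ :=
    ContDiffAt.exists_forall_mem_closedBall_exists_eq_forall_mem_Ioo_hasDerivAt
      ((hf z₀ hz).of_le (by norm_cast)) 0
  obtain ⟨γ, hγ0, hγ⟩ := h z₀ (Metric.mem_closedBall_self hr.le)
  rw [zero_sub, zero_add] at hγ
  have hcont : ContinuousAt γ 0 := (hγ 0 ⟨neg_lt_zero.2 hε, hε⟩).continuousAt
  -- The time interval is shrunk to keep the solution inside O, where f is smooth.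
  obtain ⟨δ, hδ, hball⟩ := Metric.mem_nhds_iff.1
    (hcont.preimage_mem_nhds (hO.mem_nhds (hγ0.symm ▸ hz)))
  have hsub : ∀ t ∈ Ioo (-min ε δ) (min ε δ), t ∈ Ioo (-ε) ε ∧ γ t ∈ O := by
    intro t ht
    have h1 := min_le_left ε δ
    have h2 := min_le_right ε δ
    refine ⟨⟨by linarith [ht.1], by linarith [ht.2]⟩, hball ?_⟩
    rw [Metric.mem_ball, dist_zero_right, Real.norm_eq_abs, abs_lt]
    exact ⟨by linarith [ht.1], by linarith [ht.2]⟩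
  refine ⟨min ε δ, γ, lt_min hε hδ, hγ0, fun t ht => ⟨(hsub t ht).2, hγ t (hsub t ht).1, ?_⟩⟩
  -- Regularity of solutions is applied on a compact interval [a, b] having t in its interior.
  obtain ⟨a, ha, hat⟩ := exists_between ht.1
  obtain ⟨b, htb, hb⟩ := exists_between ht.2
  have hI : ∀ s ∈ Icc a b, s ∈ Ioo (-min ε δ) (min ε δ) := fun s hs =>
    ⟨ha.trans_le hs.1, hs.2.trans_lt hb⟩
  have hsmooth : ContDiffOn ℝ ((⊤ : ℕ∞) : ℕ∞ω) γ (Icc a b) := by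
    refine ODE.contDiffOn_enat_Icc_of_hasDerivWithinAt (f := fun _ => f) (u := O) ?_
      (fun s hs => (hγ s (hsub s (hI s hs)).1).hasDerivWithinAt) fun s hs => (hsub s (hI s hs)).2
    intro q hq
    exact ((hf q.2 hq.2).comp q contDiffAt_snd).contDiffWithinAt
  exact hsmooth.contDiffAt (Icc_mem_nhds hat htb)

/-! ### Existence of forced frame curves -/

section Existence

variable {n : ℕ} {M : Type*} [TopologicalSpace M] [ChartedSpace (Rn n) M]
  [IsManifold (𝓡 n) ∞ M]
  {V : ∀ x : M, TangentSpace (𝓡 n) x → TangentSpace (𝓡 n) x}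

variable (V) in
/-- The components in the chart at `c` of the fibrewise map `V`. -/
def forceCoords (c : M) (q : Rn n × Rn n) : Rn n :=
  coords c ((extChartAt (𝓡 n) c).symm q.1) (V ((extChartAt (𝓡 n) c).symm q.1)
    (ofCoords c ((extChartAt (𝓡 n) c).symm q.1) q.2))

lemma forceCoords_coords {c p : M} (hp : p ∈ (chartAt (Rn n) c).source)
    (w : TangentSpace (𝓡 n) p) :
    forceCoords V c (extChartAt (𝓡 n) c p, coords c p w) = coords c p (V p w) := by
  simp only [forceCoords]
  rw [symm_extChartAt hp, ofCoords_coords hp]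

lemma contDiffAt_forceCoords (hV : ContMDiff (𝓡 n).tangent (𝓡 n).tangent ∞
      (fun p : TangentBundle (𝓡 n) M => (⟨p.1, V p.1 p.2⟩ : TangentBundle (𝓡 n) M)))
    {c : M} {q : Rn n × Rn n} (hq : q.1 ∈ (extChartAt (𝓡 n) c).target) :
    ContDiffAt ℝ ∞ (forceCoords V c) q := by
  have h := (hV.contMDiffAt).comp q (contMDiffAt_ofCoords (c := c) hq)
  exact ((contMDiffAt_tangent_iff (c := c) (symm_mem_source hq)).1 h).2.contDiffAt

variable [RiemannianBundle (fun x : M => TangentSpace (𝓡 n) x)]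

variable (V) in
/-- The vector field on `ℝⁿ × ℝⁿ × Hom(ℝⁿ, ℝⁿ)` whose integral curves are, in the chart at `c`, the
forced geodesics with their velocities and parallel frames. -/
def frameField (c : M) (z : Rn n × Rn n × (Rn n →L[ℝ] Rn n)) :
    Rn n × Rn n × (Rn n →L[ℝ] Rn n) :=
  (z.2.1, forceCoords V c (z.1, z.2.1) - christoffelL c z.1 z.2.1 z.2.1,
    -(christoffelL c z.1 z.2.1).comp z.2.2)

variable [IsContMDiffRiemannianBundle (𝓡 n) ∞ (Rn n) (fun x : M => TangentSpace (𝓡 n) x)]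

lemma contDiffAt_frameField (hV : ContMDiff (𝓡 n).tangent (𝓡 n).tangent ∞
      (fun p : TangentBundle (𝓡 n) M => (⟨p.1, V p.1 p.2⟩ : TangentBundle (𝓡 n) M)))
    {c : M} {z : Rn n × Rn n × (Rn n →L[ℝ] Rn n)} (hz : z.1 ∈ (extChartAt (𝓡 n) c).target) :
    ContDiffAt ℝ ∞ (frameField V c) z := by
  have h1 : ContDiffAt ℝ ∞ (fun z : Rn n × Rn n × (Rn n →L[ℝ] Rn n) => z.1) z := contDiffAt_fst
  have h2 : ContDiffAt ℝ ∞ (fun z : Rn n × Rn n × (Rn n →L[ℝ] Rn n) => z.2.1) z :=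
    contDiffAt_fst.comp z contDiffAt_snd
  have h3 : ContDiffAt ℝ ∞ (fun z : Rn n × Rn n × (Rn n →L[ℝ] Rn n) => z.2.2) z :=
    contDiffAt_snd.comp z contDiffAt_snd
  have hΓ : ContDiffAt ℝ ∞ (fun z : Rn n × Rn n × (Rn n →L[ℝ] Rn n) =>
      christoffelL c z.1 z.2.1) z := ((contDiffAt_christoffelL hz).comp z h1).clm_apply h2
  have hF : ContDiffAt ℝ ∞ (fun z : Rn n × Rn n × (Rn n →L[ℝ] Rn n) =>
      forceCoords V c (z.1, z.2.1)) z :=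
    ContDiffAt.comp z (g := forceCoords V c)
      (contDiffAt_forceCoords hV (q := (z.1, z.2.1)) hz) (h1.prodMk h2)
  exact h2.prodMk ((hF.sub (hΓ.clm_apply h2)).prodMk (hΓ.clm_comp h3).neg)

/-- An integral curve (y, p, A) of `frameField` in the chart at π(u) is read back as the frame with
matrix A over the point with coordinates y. -/
lemma exists_isForcedFrameCurve (hV : ContMDiff (𝓡 n).tangent (𝓡 n).tangent ∞
      (fun p : TangentBundle (𝓡 n) M => (⟨p.1, V p.1 p.2⟩ : TangentBundle (𝓡 n) M)))
    (u : HomBundle n M) (v : Rn n) :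
    ∃ (ε : ℝ) (τ : ℝ → HomBundle n M) (vt : ℝ → Rn n), IsForcedFrameCurve V u v ε τ vt := by
  set c : M := u.proj
  have hcc : u.proj ∈ (chartAt (Rn n) c).source := mem_chart_source _ _
  obtain ⟨ε, γ, hε, hγ0, hγ⟩ := exists_smooth_integralCurve
    (f := frameField V c) (O := {z | z.1 ∈ (extChartAt (𝓡 n) c).target})
    ((isOpen_extChartAt_target c).preimage continuous_fst)
    (fun z hz => contDiffAt_frameField hV hz)
    (z₀ := (extChartAt (𝓡 n) c u.proj, homCoords c u v, homCoords c u))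
    (extChartAt_mem_target hcc)
  set y : ℝ → Rn n := fun t => (γ t).1 with hy
  set p : ℝ → Rn n := fun t => (γ t).2.1 with hp
  set A : ℝ → (Rn n →L[ℝ] Rn n) := fun t => (γ t).2.2 with hA
  have hy' : ∀ t ∈ Ioo (-ε) ε, HasDerivAt y (p t) t := fun t ht => (hγ t ht).2.1.fst
  have hp' : ∀ t ∈ Ioo (-ε) ε, HasDerivAt p (forceCoords V c (y t, p t) -
      christoffelL c (y t) (p t) (p t)) t := fun t ht => (hγ t ht).2.1.snd.fst
  have hA' : ∀ t ∈ Ioo (-ε) ε, HasDerivAt A (-(christoffelL c (y t) (p t)).comp (A t)) t :=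
    fun t ht => (hγ t ht).2.1.snd.snd
  have hyt : ∀ t ∈ Ioo (-ε) ε, y t ∈ (extChartAt (𝓡 n) c).target := fun t ht => (hγ t ht).1
  set τ : ℝ → HomBundle n M := fun t => ofHomCoords c ((extChartAt (𝓡 n) c).symm (y t)) (A t)
    with hτ
  have hproj : ∀ t ∈ Ioo (-ε) ε, (τ t).proj = (extChartAt (𝓡 n) c).symm (y t) := fun t ht =>
    ofHomCoords_proj (symm_mem_source (hyt t ht)) _
  have hsrc : ∀ t ∈ Ioo (-ε) ε, (τ t).proj ∈ (chartAt (Rn n) c).source := fun t ht => by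
    rw [hproj t ht]
    exact symm_mem_source (hyt t ht)
  have hchart : ∀ t ∈ Ioo (-ε) ε, extChartAt (𝓡 n) c (τ t).proj = y t := fun t ht => by
    rw [hproj t ht]
    exact (extChartAt (𝓡 n) c).right_inv (hyt t ht)
  have hhom : ∀ t ∈ Ioo (-ε) ε, homCoords c (τ t) = A t := fun t ht =>
    homCoords_ofHomCoords (symm_mem_source (hyt t ht)) _
  have hnhds : ∀ t ∈ Ioo (-ε) ε, Ioo (-ε) ε ∈ 𝓝 t := fun t ht => isOpen_Ioo.mem_nhds ht
  have hsm : ∀ t ∈ Ioo (-ε) ε, ContMDiffAt 𝓘(ℝ, ℝ) (𝓡 n) ∞ (fun s => (τ s).proj) t := by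
    intro t ht
    have h1 : ContMDiffAt 𝓘(ℝ, ℝ) 𝓘(ℝ, Rn n) ∞ y t :=
      (contDiffAt_fst.comp t (hγ t ht).2.2).contMDiffAt
    have h2 := (contMDiffAt_chart_symm (hyt t ht)).comp t h1
    exact h2.congr_of_eventuallyEq (Filter.eventuallyEq_of_mem (hnhds t ht) hproj)
  have hτsm : ∀ t ∈ Ioo (-ε) ε, ContMDiffAt 𝓘(ℝ, ℝ) (homModel n) ∞ τ t := by
    intro t ht
    rw [contMDiffAt_hom_iff (hsrc t ht)]
    refine ⟨hsm t ht, ?_⟩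
    have h1 : ContDiffAt ℝ ∞ A t := contDiffAt_snd.comp t (contDiffAt_snd.comp t (hγ t ht).2.2)
    exact (h1.congr_of_eventuallyEq
      (Filter.eventuallyEq_of_mem (hnhds t ht) hhom)).contMDiffAt
  have hyd : ∀ t ∈ Ioo (-ε) ε,
      HasDerivAt (fun s => extChartAt (𝓡 n) c (τ s).proj) (p t) t := fun t ht =>
    (hy' t ht).congr_of_eventuallyEq (Filter.eventuallyEq_of_mem (hnhds t ht) hchart)
  -- Since y' = p, the variable p is the velocity; its equation thereby becomes the second-order
  -- geodesic equation.
  have hvel : ∀ t ∈ Ioo (-ε) ε,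
      coords c (τ t).proj (velocity (𝓡 n) (fun r => (τ r).proj) t) = p t := fun t ht =>
    (coords_velocity ((hsm t ht).mdifferentiableAt (by simp)) (hsrc t ht)).unique (hyd t ht)
  have h0 : (0 : ℝ) ∈ Ioo (-ε) ε := ⟨neg_lt_zero.2 hε, hε⟩
  have hinit : τ 0 = u := by
    simp only [hτ, hy, hA, hγ0]
    rw [symm_extChartAt hcc]
    exact ofHomCoords_homCoords hcc
  refine ⟨ε, τ, fun t => invApp (τ t) (velocity (𝓡 n) (fun r => (τ r).proj) t), hε,
    fun t ht => (hsm t ht).contMDiffWithinAt, fun t ht => ?_, hinit, ?_,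
    fun α t ht => ((contMDiffAt_evalAt _ _).comp t (hτsm t ht)).contMDiffWithinAt,
    fun α t ht => ?_, fun t ht => rfl⟩
  · have hpd : HasDerivAt (fun s => coords c (τ s).proj
        (velocity (𝓡 n) (fun r => (τ r).proj) s)) _ t :=
      (hp' t ht).congr_of_eventuallyEq (Filter.eventuallyEq_of_mem (hnhds t ht) hvel)
    -- The covariant derivative is moved from the chart at x(t) to the fixed chart c, where the
    -- Christoffel terms cancel.
    rw [covDerivAlong_eq (hsrc t ht) (hsm t ht).continuousAt (hyd t ht).differentiableAt
      hpd.differentiableAt, hpd.deriv, (hyd t ht).deriv, hvel t ht, hchart t ht, sub_add_cancel,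
      ← hchart t ht, ← hvel t ht, forceCoords_coords (hsrc t ht), ofCoords_coords (hsrc t ht)]
  · apply coords_injective (hsrc 0 h0)
    rw [hvel 0 h0, ← homCoords_apply (hsrc 0 h0), hhom 0 h0]
    simp only [hp, hA, hγ0]
  · have hap : ∀ s ∈ Ioo (-ε) ε, coords c (τ s).proj (app (τ s) (stdVec n α)) =
        A s (stdVec n α) := fun s hs => by
      rw [← homCoords_apply (hsrc s hs), hhom s hs]
    have hAd := (hA' t ht).clm_apply (hasDerivAt_const t (stdVec n α))
    have had := hAd.congr_of_eventuallyEq (Filter.eventuallyEq_of_mem (hnhds t ht) hap)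
    rw [covDerivAlong_eq (hsrc t ht) (hsm t ht).continuousAt (hyd t ht).differentiableAt
      had.differentiableAt, had.deriv, (hyd t ht).deriv, hap t ht, hchart t ht, map_zero, add_zero]
    rw [neg_apply, ContinuousLinearMap.comp_apply, neg_add_cancel,
      ← ofCoordsL_apply (hsrc t ht), map_zero]

end Existence

end ForcedGeodesic

end

theorem mainTheorem8 {n : ℕ} {M : Type*} [TopologicalSpace M] [T2Space M]
    [SecondCountableTopology M] [ConnectedSpace M]
    [ChartedSpace (Rn n) M] [IsManifold (𝓡 n) ∞ M]
    [RiemannianBundle (fun x : M => TangentSpace (𝓡 n) x)]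
    [IsContMDiffRiemannianBundle (𝓡 n) ∞ (Rn n) (fun x : M => TangentSpace (𝓡 n) x)]
    (V : ∀ x : M, TangentSpace (𝓡 n) x → TangentSpace (𝓡 n) x)
    (hV : ContMDiff (𝓡 n).tangent (𝓡 n).tangent ∞
      (fun p : TangentBundle (𝓡 n) M => (⟨p.1, V p.1 p.2⟩ : TangentBundle (𝓡 n) M)))
    (u : HomBundle n M) (hu : u ∈ orthoFrames n M) (v : Rn n) :
    -- the horizontal lift of `u(v)` to `T_u F_O(M)` exists and is unique, and `H_v(u)` is that lift
    (∃! ξ : TangentSpace (homModel n) u, IsHorizontalLift u (app u v) ξ) ∧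
    IsHorizontalLift u (app u v) (canonicalHorizontal v u) ∧
    -- the curve that defines `X` at `(u, v)` exists
    (∃ (ε : ℝ) (τ : ℝ → HomBundle n M) (vt : ℝ → Rn n), IsForcedFrameCurve V u v ε τ vt) ∧
    -- any such curve is a smooth curve in `N`, and its initial velocity is `X` at `(u, v)`
    (∀ (ε : ℝ) (τ : ℝ → HomBundle n M) (vt : ℝ → Rn n), IsForcedFrameCurve V u v ε τ vt →
      ContMDiffOn 𝓘(ℝ, ℝ) (phaseModel n) ∞ (fun t => (τ t, vt t)) (Ioo (-ε) ε) ∧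
      (∀ t ∈ Ioo (-ε) ε, (τ t, vt t) ∈ phaseSpace n M) ∧
      HasVelocityAt (phaseModel n) (fun t => (τ t, vt t)) 0 (u, v) (forcedField V (u, v))) ∧
    -- `X` at `(u, v)` lies in `T_{(u,v)} N` and is given by the formula
    forcedField V (u, v) ∈ tangentTo (phaseModel n) (phaseSpace n M) (u, v) ∧
    forcedField V (u, v) =
      tangentPair (canonicalHorizontal v u) (invApp u (V u.proj (app u v))) := by
  obtain ⟨ε, τ, vt, h⟩ := exists_isForcedFrameCurve hV u v
  have hlift : ∃ ξ : TangentSpace (homModel n) u, IsHorizontalLift u (app u v) ξ := by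
    have hl := h.isHorizontalLift hu
    rw [h.init] at hl
    exact ⟨_, hl⟩
  have hcan : IsHorizontalLift u (app u v) (canonicalHorizontal v u) :=
    Classical.epsilon_spec hlift
  have hfield : forcedField V (u, v) =
      tangentPair (canonicalHorizontal v u) (invApp u (V u.proj (app u v))) := by
    -- The chosen value is the velocity of some admissible curve, possibly not the one at hand;
    -- `hasVelocityAt` computes it for all of them.
    obtain ⟨ε', τ', vt', h', hvel⟩ := Classical.epsilon_spec
      (p := fun ξ : TangentSpace (phaseModel n) (u, v) =>
        ∃ (ε : ℝ) (τ : ℝ → HomBundle n M) (vt : ℝ → Rn n), IsForcedFrameCurve V u v ε τ vt ∧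
          HasVelocityAt (phaseModel n) (fun t => (τ t, vt t)) 0 (u, v) ξ)
      ⟨_, ε, τ, vt, h, h.hasVelocityAt hu⟩
    exact TotalSpace.mk_injective _ (hvel.2.symm.trans (h'.hasVelocityAt hu).2)
  refine ⟨⟨_, hcan, fun ξ hξ => horizontalLift_unique hξ hcan⟩, hcan, ⟨ε, τ, vt, h⟩,
    fun ε τ vt h => ⟨fun t ht => (h.contMDiffAt_pair hu ht).contMDiffWithinAt,
      fun t ht => ⟨h.mem_orthoFrames hu ht, mem_univ _⟩, ?_⟩, ?_, hfield⟩
  · rw [hfield]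
    exact h.hasVelocityAt hu
  · rw [hfield]
    exact ⟨ε, fun t => (τ t, vt t), h.pos, fun t ht => (h.contMDiffAt_pair hu ht).contMDiffWithinAt,
      fun t ht => ⟨h.mem_orthoFrames hu ht, mem_univ _⟩, h.hasVelocityAt hu⟩
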